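/- Let $T\ge 0$, let $(\Omega,\mathcal F,\mathbb F=(\mathcal F_t)_{t\in[0,T]},\mathbb P)$ be a filtered probability space satisfying the usual conditions, let $U$ and $H$ be separable real Hilbert spaces, and let $L_2(U,H)$ be the space of Hilbert--Schmidt operators from $U$ to $H$. Let $W$ be a $U$-cylindrical Brownian motion with respect to $\mathbb F$, i.e., a linear isometry $W:L^2([0,T],U)\to L^2(\Omega,\mathbb R)$ with values in centered Gaussian random variables such that, for all $u\in U$ and $0\le s\le t\le T$, $W(1_{(0,t]}u)$ is $\mathcal F_t$-measurable and $W(1_{(s,t]}u)$ is independent of $\mathcal F_s$. Let $E$ be a real Banach space and let $S:\mathbb R_{\ge 0}\to L(E)$ be a strongly continuous semigroup. For a normed space $V$, let $C_{\mathbb F}([0,T],L^2(\Omega,V))$ be the space of continuous functions $Z:[0,T]\to L^2(\Omega,V)$ such that $Z_t$ is $\mathcal F_t$-measurable for every $t$, with the supremum norm, and let $L(E,\cdot)$ denote bounded linear operators with the operator norm. Let $X_0\in L(E,L^2((\Omega,\mathcal F_0,\mathbb P),H))$, and let \begin{align*} F:L(E,C_{\mathbb F}([0,T],L^2(\Omega,H)))&\to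 L(E,C_{\mathbb F}([0,T],L^2(\Omega,H))),\\ G:L(E,C_{\mathbb F}([0,T],L^2(\Omega,H)))&\to L(E,C_{\mathbb F}([0,T],L^2(\Omega,L_2(U,H)))) \end{align*} be Lipschitz continuous and non-anticipating, where $F$ is called non-anticipating if for all $t\in[0,T]$ and all $X,Y$ with $X(e)_s=Y(e)_s$ for all $s\le t$ and $e\in E$, one has $F(X)(e)_t=F(Y)(e)_t$ for all $e\in E$, and similarly for $G$. Then there exists a unique $X\in L(E,C_{\mathbb F}([0,T],L^2(\Omega,H)))$ which satisfies $$X_t=S_t^*X_0+\int_0^t S_{t-s}^*F(X)_s\,ds+\int_0^t S_{t-s}^*G(X)_s\,dW_s\qquad\text{for all }t\in[0,T],$$ where the integrals are $E$-cylindrical, i.e., for all $t\in[0,T]$ and $e\in E$ one has, in $L^2(\Omega,H)$, $$X(e)_t=X_0(S_te)+\int_0^t F(X)(S_{t-s}e)_s\,ds+\int_0^t G(X)(S_{t-s}e)_s\,dW_s .$$ Here the first integral is a pathwise Bochner integral and the second one is an Itô integral, both taken over predictable versions of the integrands $s\mapsto 1_{[0,t]}(s)\,F(X)(S_{t-s}e)_s$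 and $s\mapsto 1_{[0,t]}(s)\,G(X)(S_{t-s}e)_s$. -/

import Mathlib

open MeasureTheory ProbabilityTheory Filter Topology
open scoped NNReal ENNReal

/-! ### Hilbert-Schmidt operators -/

section HilbertSchmidt

variable (U H : Type*)
  [NormedAddCommGroup U] [InnerProductSpace ℝ U] [CompleteSpace U]
  [NormedAddCommGroup H] [InnerProductSpace ℝ H]

/-- The index set of a fixed Hilbert basis (complete orthonormal system) of `U`. -/
noncomputable def hbIndex : Set U := (exists_hilbertBasis ℝ U).choose

/-- A fixed Hilbert basis of `U`. -/
noncomputable def hbBasis : HilbertBasis (hbIndex U) ℝ U :=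
  (exists_hilbertBasis ℝ U).choose_spec.choose

/-- The bounded operators `A : U → H` with `∑ i, ‖A bᵢ‖ ^ 2 < ∞`. Neither this condition nor the
value of the sum depends on the choice of the orthonormal basis `b`. -/
noncomputable def hsSubmodule : Submodule ℝ (U →L[ℝ] H) where
  carrier := {A | Memℓp (fun i : hbIndex U => A (hbBasis U i)) 2}
  zero_mem' := by
    have : Memℓp (0 : hbIndex U → H) 2 := zero_memℓp
    exact this
  add_mem' {A B} hA hB := by
    have : Memℓp ((fun i : hbIndex U => A (hbBasis U i)) +
      (fun i : hbIndex U => B (hbBasis U i))) 2 := hA.add hB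
    exact this
  smul_mem' c A hA := by
    have : Memℓp (c • (fun i : hbIndex U => A (hbBasis U i))) 2 := hA.const_smul c
    exact this

/-- The space `L₂(U, H)` of Hilbert-Schmidt operators. It is a type of its own, because it carries
the Hilbert-Schmidt norm and not the operator norm. -/
def HilbertSchmidt : Type _ := ↥(hsSubmodule U H)

namespace HilbertSchmidt

noncomputable instance : AddCommGroup (HilbertSchmidt U H) :=
  inferInstanceAs (AddCommGroup ↥(hsSubmodule U H))

noncomputable instance : Module ℝ (HilbertSchmidt U H) :=
  inferInstanceAs (Module ℝ ↥(hsSubmodule U H))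

/-- A Hilbert-Schmidt operator as the square-summable family of its values on the basis. -/
noncomputable def coeffs : HilbertSchmidt U H →ₗ[ℝ] lp (fun _ : hbIndex U => H) 2 where
  toFun A := ⟨fun i => A.1 (hbBasis U i), A.2⟩
  map_add' _ _ := rfl
  map_smul' _ _ := rfl

theorem coeffs_injective : Function.Injective (coeffs U H) := by
  intro A B h
  apply Subtype.ext
  refine ContinuousLinearMap.ext_on (s := Set.range (hbBasis U)) ?_ ?_
  · have h2 := (hbBasis U).dense_span
    rw [← Submodule.dense_iff_topologicalClosure_eq_top] at h2
    exact h2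
  · rintro _ ⟨i, rfl⟩
    have h3 := congrArg (fun f : lp (fun _ : hbIndex U => H) 2 => f i) h
    exact h3

/-- The Hilbert-Schmidt norm `‖A‖ = (∑ i, ‖A bᵢ‖ ^ 2) ^ (1 / 2)`. -/
noncomputable instance : NormedAddCommGroup (HilbertSchmidt U H) :=
  NormedAddCommGroup.induced _ _ (coeffs U H) (coeffs_injective U H)

noncomputable instance : NormedSpace ℝ (HilbertSchmidt U H) :=
  NormedSpace.induced ℝ _ _ (coeffs U H)

theorem norm_sq_eq (A : HilbertSchmidt U H) : ‖A‖ ^ 2 = ∑' i, ‖A.1 (hbBasis U i)‖ ^ 2 := by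
  have h := lp.norm_rpow_eq_tsum (p := 2) (by norm_num) (coeffs U H A)
  simp only [ENNReal.toReal_ofNat, Real.rpow_ofNat] at h
  exact h

variable {U H}

/-- The rank-one operator `h ⊗ u : v ↦ ⟪u, v⟫ h`. -/
noncomputable def rankOne (h : H) (u : U) : HilbertSchmidt U H :=
  ⟨(innerSL ℝ u).smulRight h, by
    have hs : Summable fun i : hbIndex U => ‖inner ℝ (hbBasis U i) u‖ ^ 2 :=
      (hbBasis U).orthonormal.inner_products_summable u
    refine memℓp_gen ?_
    simp only [ENNReal.toReal_ofNat, Real.rpow_ofNat]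
    refine (hs.mul_right (‖h‖ ^ 2)).congr fun i => ?_
    rw [ContinuousLinearMap.smulRight_apply, norm_smul, mul_pow, innerSL_apply_apply,
      real_inner_comm]⟩

end HilbertSchmidt

end HilbertSchmidt

/-! ### Strongly continuous semigroups -/

/-- A strongly continuous semigroup of bounded operators on `E`. -/
structure C0Semigroup (E : Type*) [NormedAddCommGroup E] [NormedSpace ℝ E] where
  /-- The operators `S t`. -/
  toFun : ℝ≥0 → E →L[ℝ] E
  map_zero : toFun 0 = ContinuousLinearMap.id ℝ E
  map_add : ∀ s t, toFun (s + t) = (toFun s).comp (toFun t)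
  continuous_orbit : ∀ e, Continuous fun t => toFun t e

/-! ### Filtered probability spaces and processes on `[0, T]` -/

section Stochastic

variable {T : ℝ} [Fact (0 ≤ T)] {Ω : Type*} {mΩ : MeasurableSpace Ω}

/-- Lebesgue measure on `[0, T]`. -/
noncomputable def timeMeasure (T : ℝ) : Measure (Set.Icc (0 : ℝ) T) :=
  Measure.comap Subtype.val volume

instance (T : ℝ) : IsFiniteMeasure (timeMeasure T) :=
  ⟨by
    rw [timeMeasure, comap_subtype_coe_apply measurableSet_Icc]
    exact (measure_mono (Subtype.coe_image_subset _ _)).trans_lt measure_Icc_lt_top⟩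

/-- The usual conditions: right-continuity, and `𝓕 0` contains every subset of a null set. -/
structure UsualConditions (𝓕 : Filtration (Set.Icc (0 : ℝ) T) mΩ) (P : Measure Ω) : Prop where
  rightCont : 𝓕.IsRightContinuous
  complete : ∀ A : Set Ω, P A = 0 → MeasurableSet[𝓕 ⊥] A

/-- The continuous functions `X : [0, T] → L²(Ω, V)` which are adapted, i.e. `X t` is (the class of)
an `𝓕 t`-measurable random variable for each `t`. -/
noncomputable def adaptedSubmodule (𝓕 : Filtration (Set.Icc (0 : ℝ) T) mΩ) (P : Measure Ω)
    (V : Type*) [NormedAddCommGroup V] [NormedSpace ℝ V] :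
    Submodule ℝ C(Set.Icc (0 : ℝ) T, Lp V 2 P) where
  carrier := {X | ∀ t, X t ∈ lpMeas V ℝ (𝓕 t) 2 P}
  zero_mem' _ := Submodule.zero_mem _
  add_mem' hX hY t := Submodule.add_mem _ (hX t) (hY t)
  smul_mem' c _ hX t := Submodule.smul_mem _ c (hX t)

/-- The normed space `C_𝓕([0, T], L²(Ω, V))` of continuous adapted functions `[0, T] → L²(Ω, V)`
with the supremum norm. -/
def AdaptedC (𝓕 : Filtration (Set.Icc (0 : ℝ) T) mΩ) (P : Measure Ω)
    (V : Type*) [NormedAddCommGroup V] [NormedSpace ℝ V] : Type _ :=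
  ↥(adaptedSubmodule 𝓕 P V)

namespace AdaptedC

variable (𝓕 : Filtration (Set.Icc (0 : ℝ) T) mΩ) (P : Measure Ω)
  (V : Type*) [NormedAddCommGroup V] [NormedSpace ℝ V]

noncomputable instance : NormedAddCommGroup (AdaptedC 𝓕 P V) :=
  inferInstanceAs (NormedAddCommGroup ↥(adaptedSubmodule 𝓕 P V))

noncomputable instance : NormedSpace ℝ (AdaptedC 𝓕 P V) :=
  inferInstanceAs (NormedSpace ℝ ↥(adaptedSubmodule 𝓕 P V))

end AdaptedC

/-- The element `1_{(s, t]} u` of `L²([0, T], U)`. -/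
noncomputable def stepL2 {U : Type*} [NormedAddCommGroup U] (s t : Set.Icc (0 : ℝ) T) (u : U) :
    Lp U 2 (timeMeasure T) :=
  indicatorConstLp 2 (measurableSet_Ioc : MeasurableSet (Set.Ioc s t)) (measure_ne_top _ _) u

/-- A `U`-cylindrical Brownian motion on `[0, T]` with respect to the filtration `𝓕`: a linear
isometry from `L²([0, T], U)` to `L²(Ω, ℝ)` with centered Gaussian values such that
`W (1_{(0, t]} u)` is `𝓕 t`-measurable and `W (1_{(s, t]} u)` is independent of `𝓕 s`. -/
structure CylindricalBM (𝓕 : Filtration (Set.Icc (0 : ℝ) T) mΩ) (P : Measure Ω)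
    (U : Type*) [NormedAddCommGroup U] [InnerProductSpace ℝ U] where
  /-- The isometry. -/
  toIsometry : Lp U 2 (timeMeasure T) →ₗᵢ[ℝ] Lp ℝ 2 P
  gaussian : ∀ f, ∃ v : ℝ≥0, P.map (toIsometry f) = gaussianReal 0 v
  adapted : ∀ t u, toIsometry (stepL2 ⊥ t u) ∈ lpMeas ℝ ℝ (𝓕 t) 2 P
  indep : ∀ s t u, s ≤ t →
    Indep (MeasurableSpace.comap (toIsometry (stepL2 s t u)) inferInstance) (𝓕 s) P

/-- An elementary predictable process `∑ k, 1_{(sₖ, tₖ] × Aₖ} (hₖ ⊗ uₖ)` with `Aₖ ∈ 𝓕 sₖ`, with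
values in the finite-rank operators from `U` to `H`. -/
structure ElementaryProcess (𝓕 : Filtration (Set.Icc (0 : ℝ) T) mΩ) (U H : Type*) where
  /-- The number of terms. -/
  n : ℕ
  /-- Left end points. -/
  s : Fin n → Set.Icc (0 : ℝ) T
  /-- Right end points. -/
  t : Fin n → Set.Icc (0 : ℝ) T
  /-- Events. -/
  A : Fin n → Set Ω
  /-- Vectors of `U`. -/
  u : Fin n → U
  /-- Vectors of `H`. -/
  h : Fin n → H
  le : ∀ k, s k ≤ t k
  measurable : ∀ k, MeasurableSet[𝓕 (s k)] (A k)

section Ito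

variable {𝓕 : Filtration (Set.Icc (0 : ℝ) T) mΩ} {P : Measure Ω} {U H : Type*}
  [NormedAddCommGroup U] [InnerProductSpace ℝ U] [CompleteSpace U]
  [NormedAddCommGroup H] [InnerProductSpace ℝ H]

/-- The elementary process as a function on `[0, T] × Ω`. -/
noncomputable def ElementaryProcess.eval (φ : ElementaryProcess 𝓕 U H) :
    Set.Icc (0 : ℝ) T × Ω → HilbertSchmidt U H :=
  fun x => ∑ k, (Set.Ioc (φ.s k) (φ.t k) ×ˢ φ.A k).indicator
    (fun _ => HilbertSchmidt.rankOne (φ.h k) (φ.u k)) x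

/-- The elementary Itô integral `∑ k, 1_{Aₖ} W(1_{(sₖ, tₖ]} uₖ) hₖ`. -/
noncomputable def ElementaryProcess.integral (φ : ElementaryProcess 𝓕 U H)
    (W : CylindricalBM 𝓕 P U) : Ω → H :=
  fun ω => ∑ k, (φ.A k).indicator
    (fun ω' => W.toIsometry (stepL2 (φ.s k) (φ.t k) (φ.u k)) ω' • φ.h k) ω

/-- `Φ` is a predictable version of the `L²(Ω, V)`-valued process `Z`. -/
def IsPredictableVersion (𝓕 : Filtration (Set.Icc (0 : ℝ) T) mΩ) {V : Type*}
    [NormedAddCommGroup V] (Φ : Set.Icc (0 : ℝ) T → Ω → V)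
    (Z : Set.Icc (0 : ℝ) T → Lp V 2 P) : Prop :=
  IsStronglyPredictable 𝓕 Φ ∧ ∀ s, Φ s =ᵐ[P] Z s

/-- `Y = ∫_0^T Z dW` in the sense of Itô: some predictable version `Φ` of `Z` is the limit in
`L²([0, T] × Ω, dt ⊗ P; L₂(U, H))` of elementary processes whose integrals converge to `Y` in
`L²(Ω, H)`. -/
def IsItoIntegral (W : CylindricalBM 𝓕 P U) (Z : Set.Icc (0 : ℝ) T → Lp (HilbertSchmidt U H) 2 P)
    (Y : Lp H 2 P) : Prop :=
  ∃ Φ : Set.Icc (0 : ℝ) T → Ω → HilbertSchmidt U H, IsPredictableVersion 𝓕 Φ Z ∧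
    ∃ φ : ℕ → ElementaryProcess 𝓕 U H,
      Tendsto (fun n => eLpNorm (fun x : Set.Icc (0 : ℝ) T × Ω => Φ x.1 x.2 - (φ n).eval x) 2
        ((timeMeasure T).prod P)) atTop (𝓝 0) ∧
      Tendsto (fun n => eLpNorm (fun ω => Y ω - (φ n).integral W ω) 2 P) atTop (𝓝 0)

/-- `Y = ∫_0^T Z ds` as a pathwise Bochner integral of a predictable version of `Z`. -/
def IsPathwiseIntegral (𝓕 : Filtration (Set.Icc (0 : ℝ) T) mΩ)
    (Z : Set.Icc (0 : ℝ) T → Lp H 2 P) (Y : Lp H 2 P) : Prop :=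
  ∃ Φ : Set.Icc (0 : ℝ) T → Ω → H, IsPredictableVersion 𝓕 Φ Z ∧
    ∀ᵐ ω ∂P, Integrable (fun s => Φ s ω) (timeMeasure T) ∧ Y ω = ∫ s, Φ s ω ∂(timeMeasure T)

end Ito

/-! ### Cylindrical convolutions, solutions, non-anticipating coefficients -/

section Cylindrical

variable {𝓕 : Filtration (Set.Icc (0 : ℝ) T) mΩ} {P : Measure Ω}
  {E : Type*} [NormedAddCommGroup E] [NormedSpace ℝ E]

/-- The integrand `s ↦ 1_{[0, t]}(s) (S_{t-s}^* f)(e)_s = 1_{[0, t]}(s) f(S_{t-s} e)_s` of the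
`E`-cylindrical convolution of `f` at time `t`, evaluated at `e`. -/
noncomputable def convolutionIntegrand {V : Type*} [NormedAddCommGroup V] [NormedSpace ℝ V]
    (S : C0Semigroup E) (f : E →L[ℝ] AdaptedC 𝓕 P V) (e : E) (t : Set.Icc (0 : ℝ) T) :
    Set.Icc (0 : ℝ) T → Lp V 2 P :=
  (Set.Iic t).indicator fun s => (f (S.toFun (Real.toNNReal ((t : ℝ) - s)) e)).1 s

/-- The mild equation
`X_t = S_t^* X₀ + ∫_0^t S_{t-s}^* F(X)_s ds + ∫_0^t S_{t-s}^* G(X)_s dW_s` for all `t ∈ [0, T]`,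
as an identity of `E`-cylindrical random variables, i.e. evaluated at every `e ∈ E`. -/
def IsMildSolution {U H : Type*}
    [NormedAddCommGroup U] [InnerProductSpace ℝ U] [CompleteSpace U]
    [NormedAddCommGroup H] [InnerProductSpace ℝ H]
    (W : CylindricalBM 𝓕 P U) (S : C0Semigroup E) (X₀ : E →L[ℝ] lpMeas H ℝ (𝓕 ⊥) 2 P)
    (F : (E →L[ℝ] AdaptedC 𝓕 P H) → (E →L[ℝ] AdaptedC 𝓕 P H))
    (G : (E →L[ℝ] AdaptedC 𝓕 P H) → (E →L[ℝ] AdaptedC 𝓕 P (HilbertSchmidt U H)))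
    (X : E →L[ℝ] AdaptedC 𝓕 P H) : Prop :=
  ∀ (t : Set.Icc (0 : ℝ) T) (e : E), ∃ I J : Lp H 2 P,
    IsPathwiseIntegral 𝓕 (convolutionIntegrand S (F X) e t) I ∧
    IsItoIntegral W (convolutionIntegrand S (G X) e t) J ∧
    (X e).1 t = (X₀ (S.toFun (Real.toNNReal t) e)).1 + I + J

/-- A coefficient `F` is non-anticipating if `F(X)` at time `t` depends only on the restriction of
`X` to `[0, t]`. -/
def IsNonanticipating {V V' : Type*} [NormedAddCommGroup V] [NormedSpace ℝ V]
    [NormedAddCommGroup V'] [NormedSpace ℝ V']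
    (F : (E →L[ℝ] AdaptedC 𝓕 P V) → (E →L[ℝ] AdaptedC 𝓕 P V')) : Prop :=
  ∀ (X Y : E →L[ℝ] AdaptedC 𝓕 P V) (t : Set.Icc (0 : ℝ) T),
    (∀ s ≤ t, ∀ e, (X e).1 s = (Y e).1 s) → ∀ e, (F X e).1 t = (F Y e).1 t

end Cylindrical

end Stochastic

/-! ### The Hilbert space of Hilbert-Schmidt operators -/

namespace HilbertSchmidt

variable {U H : Type*}
  [NormedAddCommGroup U] [InnerProductSpace ℝ U] [CompleteSpace U]
  [NormedAddCommGroup H] [InnerProductSpace ℝ H]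

/-! The mild equation is a fixed point equation `Ψ X = X` with `Ψ X = A + I (F X) + J (G X)`, where
`A` is the orbit of the initial value and `I`, `J` are the cylindrical deterministic and stochastic
convolutions. Some iterate of `Ψ` is a contraction of the Banach space `L(E, C_𝓕([0, T], L²(Ω,
H)))`, so Banach's fixed point theorem applies.

Both integrals enter only through `IsIntegralRelation`: a linear relation between integrands and
integrals, with an `L²` bound, and with existence and adaptedness for continuous adapted integrands
cut off at `t`. The bound makes integrals unique. For the pathwise integral it is Cauchy–Schwarz in
time followed by Tonelli, with constant `T`. For the Itô integral it is the Itô isometry, with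
constant `1`: the inner products of indicators of predictable rectangles and of their integrals
agree by `CylindricalBM.setIntegral_inter_mul`, and this passes to the span and to the closure of
the graph.

Existence of integrals rests on step processes taken at left end points. They approximate a
continuous adapted process uniformly in `L²(Ω)`; their limits give predictable versions
(`AdaptedC.exists_isPredictableVersion`) and place these in the closed domain of the Itô integral
(`ContainsRectangles.toLp_mem`). Strong continuity of the semigroup and dominated convergence make
the convolutions continuous in time (`IsIntegralRelation.exists_convolution`).

For the contraction, stopping both arguments at time `s` turns a Lipschitz non-anticipating
coefficient into one that is Lipschitz with respect to the history up to `s`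
(`IsNonanticipating.norm_sq_le`). If two arguments differ in squared norm by at most `B t ^ n`,
their images under `Ψ` differ by at most `L B t ^ (n + 1) / (n + 1)`. Iteration yields the factor
`(L T) ^ n / n!`, which tends to zero (`existsUnique_fixedPoint_of_gain`). -/

noncomputable instance : InnerProductSpace ℝ (HilbertSchmidt U H) where
  inner A B := inner ℝ (coeffs U H A) (coeffs U H B)
  norm_sq_eq_re_inner A := norm_sq_eq_re_inner (𝕜 := ℝ) (coeffs U H A)
  conj_inner_symm A B := inner_conj_symm (coeffs U H A) (coeffs U H B)
  add_left A B C := by rw [map_add, inner_add_left]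
  smul_left A B c := by rw [map_smul, inner_smul_left]

theorem inner_eq_tsum (A B : HilbertSchmidt U H) :
    inner ℝ A B = ∑' i, inner ℝ (A.1 (hbBasis U i)) (B.1 (hbBasis U i)) :=
  lp.inner_eq_tsum (coeffs U H A) (coeffs U H B)

theorem rankOne_apply (h : H) (u v : U) : (rankOne h u).1 v = inner ℝ u v • h := rfl

/-- Parseval's identity for `u` and `u'`. This is the operator-valued factor in the Itô isometry on
rectangles. -/
theorem inner_rankOne (h h' : H) (u u' : U) :
    inner ℝ (rankOne h u) (rankOne h' u') = inner ℝ u u' * inner ℝ h h' := by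
  rw [inner_eq_tsum]
  simp only [rankOne_apply, inner_smul_left, inner_smul_right]
  rw [← (hbBasis U).tsum_inner_mul_inner u u', ← tsum_mul_right]
  refine tsum_congr fun i => ?_
  rw [real_inner_comm (hbBasis U i) u']
  simp only [conj_trivial]
  ring

theorem rankOne_smul_left (c : ℝ) (h : H) (u : U) : rankOne (c • h) u = c • rankOne h u := by
  apply Subtype.ext
  ext v
  change inner ℝ u v • c • h = c • (inner ℝ u v • h)
  rw [smul_comm]

theorem coeffs_isometry : Isometry (coeffs U H) :=
  AddMonoidHomClass.isometry_of_norm (coeffs U H) fun _ => rfl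

open Classical in
theorem coeffs_rankOne (A : HilbertSchmidt U H) (i : hbIndex U) :
    coeffs U H (rankOne (A.1 (hbBasis U i)) (hbBasis U i)) =
      lp.single (E := fun _ : hbIndex U => H) 2 i (coeffs U H A i) := by
  ext j
  change inner ℝ (hbBasis U i) (hbBasis U j) • A.1 (hbBasis U i) = _
  have h := orthonormal_iff_ite.1 (hbBasis U).orthonormal i j
  rw [h, lp.single_apply]
  by_cases hij : i = j
  · subst hij
    simp
    rfl
  · simp [hij, Ne.symm hij]

theorem hasSum_rankOne (A : HilbertSchmidt U H) :
    HasSum (fun i => rankOne (A.1 (hbBasis U i)) (hbBasis U i)) A := by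
  classical
  rw [← coeffs_isometry.isEmbedding.isInducing.hasSum_iff (g := coeffs U H)]
  have h := lp.hasSum_single (p := 2) (by norm_num) (coeffs U H A)
  refine h.congr_fun fun i => ?_
  exact coeffs_rankOne A i

/-- Each operator is the sum of its rank-one pieces along the fixed basis, by `hasSum_rankOne`.
Density matters because elementary processes take only finite-rank values. -/
theorem closure_span_rankOne :
    (Submodule.span ℝ (Set.range fun p : H × U => rankOne p.1 p.2)).topologicalClosure = ⊤ := by
  rw [eq_top_iff]
  intro A _
  refine mem_closure_of_tendsto (hasSum_rankOne A) (Eventually.of_forall fun s => ?_)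
  exact Submodule.sum_mem _ fun i _ => Submodule.subset_span ⟨(_, _), rfl⟩

theorem summable_inner_smul (a : lp (fun _ : hbIndex U => H) 2) (u : U) :
    Summable (fun i => ‖inner ℝ (hbBasis U i) u • a i‖) := by
  have h1 : Summable fun i : hbIndex U => ‖inner ℝ (hbBasis U i) u‖ ^ 2 :=
    (hbBasis U).orthonormal.inner_products_summable u
  have h2 : Summable fun i : hbIndex U => ‖a i‖ ^ 2 := by
    simpa using (lp.memℓp a).summable (by norm_num)
  refine ((h1.add h2)).of_nonneg_of_le (fun _ => norm_nonneg _) fun i => ?_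
  rw [norm_smul]
  nlinarith [sq_nonneg (‖inner ℝ (hbBasis U i) u‖ - ‖a i‖), sq_nonneg (‖inner ℝ (hbBasis U i) u‖), sq_nonneg ‖a i‖]

/-- Cauchy–Schwarz for the sum, then Bessel's inequality for the coefficients of `u`. -/
theorem norm_tsum_inner_smul_le (a : lp (fun _ : hbIndex U => H) 2) (u : U) :
    ‖∑' i, inner ℝ (hbBasis U i) u • a i‖ ≤ ‖a‖ * ‖u‖ := by
  refine (norm_tsum_le_tsum_norm (summable_inner_smul a u)).trans ?_
  have h1 : Summable fun i : hbIndex U => ‖inner ℝ (hbBasis U i) u‖ ^ (2 : ℝ) := by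
    simpa using (hbBasis U).orthonormal.inner_products_summable u
  have h2 : Summable fun i : hbIndex U => ‖a i‖ ^ (2 : ℝ) := by
    simpa using (lp.memℓp a).summable (by norm_num)
  have h := (Real.inner_le_Lp_mul_Lq_tsum_of_nonneg Real.HolderConjugate.two_two
    (fun i => norm_nonneg (a i)) (fun i => norm_nonneg (inner ℝ (hbBasis U i) u)) h2 h1)
  simp only [norm_smul]
  simp_rw [mul_comm ‖inner ℝ _ u‖]
  refine h.trans ?_
  have e1 : (∑' i, ‖a i‖ ^ (2 : ℝ)) ^ (1 / (2 : ℝ)) = ‖a‖ := by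
    rw [lp.norm_eq_tsum_rpow (by norm_num)]; simp
  have e2 : (∑' i, ‖inner ℝ (hbBasis U i) u‖ ^ (2 : ℝ)) ^ (1 / (2 : ℝ)) ≤ ‖u‖ := by
    have := (hbBasis U).orthonormal.tsum_inner_products_le u
    simp only [Real.rpow_ofNat]
    rw [← Real.sqrt_eq_rpow]
    exact Real.sqrt_le_iff.2 ⟨norm_nonneg _, this⟩
  rw [e1]
  exact mul_le_mul_of_nonneg_left e2 (norm_nonneg _)

variable [CompleteSpace H]

/-- A square-summable family `a` comes from the operator `u ↦ ∑ ⟪bᵢ, u⟫ aᵢ`. Completeness is thereby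
inherited from the `ℓ²` space. -/
theorem coeffs_surjective : Function.Surjective (coeffs U H) := by
  classical
  intro a
  let L : U →ₗ[ℝ] H :=
    { toFun := fun u => ∑' i, inner ℝ (hbBasis U i) u • a i
      map_add' := fun u v => by
        rw [← ((summable_inner_smul a u).of_norm).tsum_add (summable_inner_smul a v).of_norm]
        simp only [inner_add_right, add_smul]
      map_smul' := fun c u => by
        rw [RingHom.id_apply, ← ((summable_inner_smul a u).of_norm).tsum_const_smul]
        simp only [inner_smul_right, smul_smul] }
  let A : U →L[ℝ] H := L.mkContinuous ‖a‖ fun u => norm_tsum_inner_smul_le a u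
  have hA : ∀ j, A (hbBasis U j) = a j := fun j => by
    change ∑' i, inner ℝ (hbBasis U i) (hbBasis U j) • a i = a j
    rw [tsum_eq_single j]
    · rw [orthonormal_iff_ite.1 (hbBasis U).orthonormal j j]; simp
    · intro i hi
      rw [orthonormal_iff_ite.1 (hbBasis U).orthonormal i j]; simp [hi]
  refine ⟨⟨A, ?_⟩, ?_⟩
  · change Memℓp (fun i => A (hbBasis U i)) 2
    simp only [hA]
    exact lp.memℓp a
  · ext j
    exact hA j

instance : CompleteSpace (HilbertSchmidt U H) :=
  (coeffs_isometry.isUniformInducing.completeSpace_congr coeffs_surjective).2 inferInstance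

end HilbertSchmidt

/-! ### Second moments of the increments of a cylindrical Brownian motion -/

section BrownianMotion

variable {T : ℝ} {Ω : Type*} {mΩ : MeasurableSpace Ω}
  {𝓕 : Filtration (Set.Icc (0 : ℝ) T) mΩ} {P : Measure Ω}
  {U : Type*} [NormedAddCommGroup U]

theorem stepL2_add_stepL2 {s c t : Set.Icc (0 : ℝ) T} (hsc : s ≤ c) (hct : c ≤ t) (u : U) :
    stepL2 s c u + stepL2 c t u = stepL2 s t u := by
  have hd : Disjoint (Set.Ioc s c) (Set.Ioc c t) := Set.Ioc_disjoint_Ioc_of_le le_rfl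
  rw [stepL2, stepL2, ← indicatorConstLp_disjoint_union _ _ _ _ hd]
  simp only [stepL2, Set.Ioc_union_Ioc_eq_Ioc hsc hct]

theorem stepL2_add (s t : Set.Icc (0 : ℝ) T) (u v : U) :
    stepL2 s t (u + v) = stepL2 s t u + stepL2 s t v :=
  indicatorConstLp_add.symm

theorem _root_.MeasureTheory.AEStronglyMeasurable.indicator_of_le {α β : Type*}
    {m m₀ : MeasurableSpace α} {μ : Measure[m₀] α} [TopologicalSpace β] [Zero β] {f : α → β}
    (hf : AEStronglyMeasurable[m] f μ) {s : Set α} (hs : MeasurableSet[m] s) :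
    AEStronglyMeasurable[m] (s.indicator f) μ :=
  ⟨s.indicator (hf.mk f), hf.stronglyMeasurable_mk.indicator hs, hf.ae_eq_mk.indicator⟩

namespace CylindricalBM

variable [Fact (0 ≤ T)] [InnerProductSpace ℝ U] (W : CylindricalBM 𝓕 P U)

theorem integral_eq_zero (f : Lp U 2 (timeMeasure T)) : ∫ ω, W.toIsometry f ω ∂P = 0 := by
  obtain ⟨v, hv⟩ := W.gaussian f
  have h := integral_map (μ := P) (φ := W.toIsometry f) (f := id)
    (Lp.aestronglyMeasurable _).aemeasurable aestronglyMeasurable_id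
  rw [hv] at h
  simpa using h.symm.trans integral_id_gaussianReal

/-- The increment is the difference of the values at `t` and `s`, each measurable by adaptedness. -/
theorem aestronglyMeasurable_stepL2 {s t : Set.Icc (0 : ℝ) T} (hst : s ≤ t) (u : U) :
    AEStronglyMeasurable[𝓕 t] (W.toIsometry (stepL2 s t u)) P := by
  have h1 : W.toIsometry (stepL2 ⊥ s u) ∈ lpMeas ℝ ℝ (𝓕 t) 2 P := by
    have h := W.adapted s u
    rw [mem_lpMeas_iff_aestronglyMeasurable] at h ⊢
    exact h.mono (𝓕.mono hst)
  have h2 := Submodule.sub_mem _ (W.adapted t u) h1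
  rw [← map_sub, ← stepL2_add_stepL2 bot_le hst, add_sub_cancel_left] at h2
  exact mem_lpMeas_iff_aestronglyMeasurable.1 h2

theorem indepFun_stepL2 {s t : Set.Icc (0 : ℝ) T} (hst : s ≤ t) (u : U) {ξ : Ω → ℝ}
    (hξ : AEStronglyMeasurable[𝓕 s] ξ P) : IndepFun ξ (W.toIsometry (stepL2 s t u)) P := by
  have h : IndepFun (W.toIsometry (stepL2 s t u)) (hξ.mk ξ) P := by
    rw [IndepFun_iff_Indep]
    exact indep_of_indep_of_le_right (W.indep s t u hst)
      (measurable_iff_comap_le.1 hξ.stronglyMeasurable_mk.measurable)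
  exact h.symm.congr hξ.ae_eq_mk.symm EventuallyEq.rfl

theorem integral_mul_stepL2 {s t : Set.Icc (0 : ℝ) T} (hst : s ≤ t) (u : U) {ξ : Ω → ℝ}
    (hξ : AEStronglyMeasurable[𝓕 s] ξ P) :
    ∫ ω, ξ ω * W.toIsometry (stepL2 s t u) ω ∂P = 0 := by
  rw [(W.indepFun_stepL2 hst u hξ).integral_fun_mul_eq_mul_integral
    (hξ.mono (𝓕.le s)) (Lp.aestronglyMeasurable _), W.integral_eq_zero, mul_zero]

theorem integrable_mul (f g : Lp U 2 (timeMeasure T)) :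
    Integrable (fun ω => W.toIsometry f ω * W.toIsometry g ω) P :=
  (Lp.memLp _).integrable_mul (Lp.memLp _)

theorem setIntegral_mul_add_right (C : Set Ω) (f g g' : Lp U 2 (timeMeasure T)) :
    ∫ ω in C, W.toIsometry f ω * W.toIsometry (g + g') ω ∂P =
      (∫ ω in C, W.toIsometry f ω * W.toIsometry g ω ∂P) +
        ∫ ω in C, W.toIsometry f ω * W.toIsometry g' ω ∂P := by
  rw [← integral_add (W.integrable_mul f g).integrableOn (W.integrable_mul f g').integrableOn]
  refine integral_congr_ae (ae_restrict_of_ae ?_)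
  rw [map_add]
  filter_upwards [Lp.coeFn_add (W.toIsometry g) (W.toIsometry g')] with ω hω
  rw [hω, Pi.add_apply, mul_add]

theorem setIntegral_mul_comm (C : Set Ω) (f g : Lp U 2 (timeMeasure T)) :
    ∫ ω in C, W.toIsometry f ω * W.toIsometry g ω ∂P =
      ∫ ω in C, W.toIsometry g ω * W.toIsometry f ω ∂P := by
  simp_rw [mul_comm]

theorem setIntegral_mul_add_left (C : Set Ω) (f f' g : Lp U 2 (timeMeasure T)) :
    ∫ ω in C, W.toIsometry (f + f') ω * W.toIsometry g ω ∂P =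
      (∫ ω in C, W.toIsometry f ω * W.toIsometry g ω ∂P) +
        ∫ ω in C, W.toIsometry f' ω * W.toIsometry g ω ∂P := by
  simp only [W.setIntegral_mul_comm C _ g, W.setIntegral_mul_add_right]

/-- An increment is orthogonal to the earlier ones, also on an event of the past. -/
theorem setIntegral_mul_eq_zero {s t s' t' : Set.Icc (0 : ℝ) T} (hst : s ≤ t) (hts : t ≤ s')
    (hst' : s' ≤ t') (u v : U) {C : Set Ω} (hC : MeasurableSet[𝓕 s'] C) :
    ∫ ω in C, W.toIsometry (stepL2 s t u) ω * W.toIsometry (stepL2 s' t' v) ω ∂P = 0 := by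
  rw [← integral_indicator (𝓕.le _ _ hC)]
  have hξ : AEStronglyMeasurable[𝓕 s'] (C.indicator (W.toIsometry (stepL2 s t u))) P :=
    ((W.aestronglyMeasurable_stepL2 hst u).mono (𝓕.mono hts)).indicator_of_le hC
  refine Eq.trans (integral_congr_ae (Eventually.of_forall fun ω => ?_))
    (W.integral_mul_stepL2 hst' v hξ)
  by_cases h : ω ∈ C <;> simp [h]

theorem setIntegral_sq {s t : Set.Icc (0 : ℝ) T} (hst : s ≤ t) (u : U) {C : Set Ω}
    (hC : MeasurableSet[𝓕 s] C) :
    ∫ ω in C, W.toIsometry (stepL2 s t u) ω * W.toIsometry (stepL2 s t u) ω ∂P =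
      P.real C * ∫ ω, W.toIsometry (stepL2 s t u) ω * W.toIsometry (stepL2 s t u) ω ∂P := by
  have hξ : AEStronglyMeasurable[𝓕 s] (C.indicator fun _ => (1 : ℝ)) P :=
    (stronglyMeasurable_const.indicator hC).aestronglyMeasurable
  have h := (W.indepFun_stepL2 hst u hξ).comp (φ := id) (ψ := fun x => x * x) measurable_id
    (by fun_prop)
  have h2 := h.integral_fun_mul_eq_mul_integral (hξ.mono (𝓕.le s))
    ((Lp.aestronglyMeasurable _).mul (Lp.aestronglyMeasurable _))
  have h3 : ∫ ω, C.indicator (fun _ => (1 : ℝ)) ω ∂P = P.real C := by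
    rw [integral_indicator (𝓕.le _ _ hC)]; simp
  simp only [Function.comp_def, id] at h2
  rw [h3] at h2
  rw [← h2, ← integral_indicator (𝓕.le _ _ hC)]
  refine integral_congr_ae (Eventually.of_forall fun ω => ?_)
  by_cases h : ω ∈ C <;> simp [h]

/-- Independence of the past is assumed for one vector of `U` at a time, not for the pair of
increments along `u` and `v`. Polarization, with `setIntegral_sq` for `u`, `v` and `u + v`, avoids
joint independence. -/
theorem setIntegral_mul_same {s t : Set.Icc (0 : ℝ) T} (hst : s ≤ t) (u v : U) {C : Set Ω}
    (hC : MeasurableSet[𝓕 s] C) :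
    ∫ ω in C, W.toIsometry (stepL2 s t u) ω * W.toIsometry (stepL2 s t v) ω ∂P =
      P.real C * ∫ ω, W.toIsometry (stepL2 s t u) ω * W.toIsometry (stepL2 s t v) ω ∂P := by
  have h1 := W.setIntegral_sq hst u hC
  have h2 := W.setIntegral_sq hst v hC
  have h3 := W.setIntegral_sq hst (u + v) hC
  rw [← setIntegral_univ (μ := P)] at h1 h2 h3 ⊢
  simp only [stepL2_add, setIntegral_mul_add_left, setIntegral_mul_add_right,
    W.setIntegral_mul_comm _ (stepL2 s t v) (stepL2 s t u)] at h3
  linarith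

/-- Split the longer interval at `t`: its later part is orthogonal to the increment over `(s, t]`,
also on `C`. -/
theorem setIntegral_mul_sameLeft {s t t' : Set.Icc (0 : ℝ) T} (hst : s ≤ t) (htt' : t ≤ t')
    (u v : U) {C : Set Ω} (hC : MeasurableSet[𝓕 s] C) :
    ∫ ω in C, W.toIsometry (stepL2 s t u) ω * W.toIsometry (stepL2 s t' v) ω ∂P =
      P.real C * ∫ ω, W.toIsometry (stepL2 s t u) ω * W.toIsometry (stepL2 s t' v) ω ∂P := by
  have h1 := W.setIntegral_mul_same hst u v hC
  rw [← setIntegral_univ (μ := P)] at h1 ⊢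
  rw [← stepL2_add_stepL2 hst htt' v, setIntegral_mul_add_right, setIntegral_mul_add_right, h1,
    W.setIntegral_mul_eq_zero hst le_rfl htt' u v (𝓕.mono hst _ hC),
    W.setIntegral_mul_eq_zero hst le_rfl htt' u v MeasurableSet.univ, add_zero, add_zero]

/-- If the intervals overlap, split the earlier one at `s'`. The part before `s'` contributes
nothing, and the rest has left end point `s'` in common with the other interval. -/
theorem setIntegral_mul_of_le {s t s' t' : Set.Icc (0 : ℝ) T} (hst : s ≤ t) (hst' : s' ≤ t')
    (hss' : s ≤ s') (u v : U) {C : Set Ω} (hC : MeasurableSet[𝓕 s'] C) :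
    ∫ ω in C, W.toIsometry (stepL2 s t u) ω * W.toIsometry (stepL2 s' t' v) ω ∂P =
      P.real C * ∫ ω, W.toIsometry (stepL2 s t u) ω * W.toIsometry (stepL2 s' t' v) ω ∂P := by
  rcases le_total t s' with h | h
  · rw [← setIntegral_univ (μ := P), W.setIntegral_mul_eq_zero hst h hst' u v hC,
      W.setIntegral_mul_eq_zero hst h hst' u v MeasurableSet.univ, mul_zero]
  · have h1 : ∫ ω in C, W.toIsometry (stepL2 s' t u) ω * W.toIsometry (stepL2 s' t' v) ω ∂P =
        P.real C * ∫ ω, W.toIsometry (stepL2 s' t u) ω * W.toIsometry (stepL2 s' t' v) ω ∂P := by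
      rcases le_total t t' with h' | h'
      · exact W.setIntegral_mul_sameLeft h h' u v hC
      · have h2 := W.setIntegral_mul_sameLeft hst' h' v u hC
        rw [← setIntegral_univ (μ := P)] at h2 ⊢
        rwa [W.setIntegral_mul_comm, W.setIntegral_mul_comm Set.univ]
    rw [← setIntegral_univ (μ := P)] at h1 ⊢
    rw [← stepL2_add_stepL2 hss' h u, setIntegral_mul_add_left, setIntegral_mul_add_left, h1,
      W.setIntegral_mul_eq_zero hss' le_rfl hst' u v hC,
      W.setIntegral_mul_eq_zero hss' le_rfl hst' u v MeasurableSet.univ, zero_add, zero_add]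

/-- The second moments of the increments, localized at past events `A` and `B`. -/
theorem setIntegral_inter_mul [CompleteSpace U] {s t s' t' : Set.Icc (0 : ℝ) T} (hst : s ≤ t)
    (hst' : s' ≤ t') (u v : U) {A B : Set Ω} (hA : MeasurableSet[𝓕 s] A)
    (hB : MeasurableSet[𝓕 s'] B) :
    ∫ ω in A ∩ B, W.toIsometry (stepL2 s t u) ω * W.toIsometry (stepL2 s' t' v) ω ∂P =
      P.real (A ∩ B) * ((timeMeasure T).real (Set.Ioc s t ∩ Set.Ioc s' t') * inner ℝ u v) := by
  have h : ∫ ω in A ∩ B, W.toIsometry (stepL2 s t u) ω * W.toIsometry (stepL2 s' t' v) ω ∂P =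
      P.real (A ∩ B) *
        ∫ ω, W.toIsometry (stepL2 s t u) ω * W.toIsometry (stepL2 s' t' v) ω ∂P := by
    rcases le_total s s' with h | h
    · exact W.setIntegral_mul_of_le hst hst' h u v ((𝓕.mono h _ hA).inter hB)
    · have h2 := W.setIntegral_mul_of_le hst' hst h v u (hA.inter (𝓕.mono h _ hB))
      rw [← setIntegral_univ (μ := P)] at h2 ⊢
      rwa [W.setIntegral_mul_comm, W.setIntegral_mul_comm Set.univ]
  have h3 : ∫ ω, W.toIsometry (stepL2 s t u) ω * W.toIsometry (stepL2 s' t' v) ω ∂P =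
      inner ℝ (W.toIsometry (stepL2 s' t' v)) (W.toIsometry (stepL2 s t u)) := by
    rw [L2.inner_def]
    rfl
  rw [h, h3, LinearIsometry.inner_map_map, real_inner_comm, stepL2, stepL2,
    L2.inner_indicatorConstLp_indicatorConstLp, smul_eq_mul]

end CylindricalBM

end BrownianMotion

/-! ### Predictable versions -/

section GeneralMeasure

variable {α : Type*} {mα : MeasurableSpace α} {μ : Measure α} {V : Type*} [NormedAddCommGroup V]

theorem eLpNorm_two_sq (f : α → V) : eLpNorm f 2 μ ^ 2 = ∫⁻ x, ‖f x‖ₑ ^ 2 ∂μ := by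
  have h := eLpNorm_nnreal_pow_eq_lintegral (f := f) (μ := μ) (p := 2) two_ne_zero
  simpa using h

theorem Lp.enorm_sq_eq_lintegral (f : Lp V 2 μ) : ‖f‖ₑ ^ 2 = ∫⁻ x, ‖f x‖ₑ ^ 2 ∂μ := by
  rw [Lp.enorm_def, eLpNorm_two_sq]

/-- Summable convergence in `L²` of a probability space implies convergence almost everywhere. -/
theorem ae_tendsto_of_eLpNorm_le [IsProbabilityMeasure μ] {f : ℕ → α → V} {g : α → V}
    (hf : ∀ n, AEStronglyMeasurable (f n) μ) (hg : AEStronglyMeasurable g μ) {b : ℕ → ℝ≥0∞}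
    (hb : ∑' n, b n ≠ ∞) (h : ∀ n, eLpNorm (f n - g) 2 μ ≤ b n) :
    ∀ᵐ x ∂μ, Tendsto (fun n => f n x) atTop (𝓝 (g x)) := by
  -- On a probability space the `L¹` norm is at most the `L²` norm, so the sum of the errors is
  -- integrable, hence finite almost everywhere, and its terms tend to zero.
  have h1 : ∫⁻ x, ∑' n, ‖f n x - g x‖ₑ ∂μ ≠ ∞ := by
    rw [lintegral_tsum (f := fun n x => ‖f n x - g x‖ₑ) fun n => ((hf n).sub hg).enorm]
    refine ne_top_of_le_ne_top hb (ENNReal.tsum_le_tsum fun n => ?_)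
    refine le_trans ?_ (h n)
    have := eLpNorm_le_eLpNorm_of_exponent_le (μ := μ) (p := 1) (q := 2) one_le_two
      ((hf n).sub hg)
    rwa [eLpNorm_one_eq_lintegral_enorm] at this
  have h2 := ae_lt_top' (AEMeasurable.tsum fun n => ((hf n).sub hg).enorm) h1
  filter_upwards [h2] with x hx
  have h3 := ENNReal.tendsto_atTop_zero_of_tsum_ne_top hx.ne
  rw [tendsto_iff_edist_tendsto_0]
  simpa only [edist_eq_enorm_sub, Pi.sub_apply] using h3

end GeneralMeasure

section Predictable

variable {T : ℝ} {Ω : Type*} {mΩ : MeasurableSpace Ω}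
  {𝓕 : Filtration (Set.Icc (0 : ℝ) T) mΩ} {P : Measure Ω}
  {V : Type*}

/-- Lets exceptional single times be ignored: time zero in the step approximations, and the cut-off
time in the continuity of convolutions. -/
instance : NullSingletonClass (timeMeasure T) :=
  ⟨fun x => by
    rw [timeMeasure, comap_subtype_coe_apply measurableSet_Icc, Set.image_singleton]
    exact measure_singleton _⟩

theorem timeMeasure_univ : timeMeasure T Set.univ = ENNReal.ofReal T := by
  rw [timeMeasure, comap_subtype_coe_apply measurableSet_Icc, Set.image_univ, Subtype.range_coe,
    Real.volume_Icc, sub_zero]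

/-- A process which is constant in time on `I`, and zero outside `I`, is measurable for a
`σ`-algebra which contains the corresponding measurable rectangles. -/
theorem stronglyMeasurable_uncurry_indicator {ι : Type*} [TopologicalSpace V] [Zero V]
    {m : MeasurableSpace Ω} {m' : MeasurableSpace (ι × Ω)} {I : Set ι}
    (hI : ∀ A, MeasurableSet[m] A → MeasurableSet[m'] (I ×ˢ A)) {η : Ω → V}
    (hη : StronglyMeasurable[m] η) :
    StronglyMeasurable[m'] (Function.uncurry fun s ω => I.indicator (fun _ => η ω) s) := by
  have heq : ∀ f : Ω → V, (Function.uncurry fun s ω => I.indicator (fun _ => f ω) s) =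
      (I ×ˢ (Set.univ : Set Ω)).indicator fun x => f x.2 := by
    intro f
    ext ⟨s, ω⟩
    by_cases h : s ∈ I <;> simp [h]
  have hu : MeasurableSet[m'] (I ×ˢ (Set.univ : Set Ω)) := hI _ MeasurableSet.univ
  -- The simple approximations of `η`, extended by zero outside `I`, are simple for `m'`: their
  -- fibres are built from rectangles over `I`. The `σ`-algebra `m'` need not be a product.
  refine ⟨fun n => @SimpleFunc.mk _ m' _
    (Function.uncurry fun s ω => I.indicator (fun _ => hη.approx n ω) s) ?_ ?_, ?_⟩
  · intro y
    rw [heq, Set.indicator_preimage]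
    have h1 : MeasurableSet[m'] ((fun x : ι × Ω => hη.approx n x.2) ⁻¹' {y} ∩ I ×ˢ Set.univ) := by
      convert! hI _ ((hη.approx n).measurableSet_fiber y) using 1
      ext ⟨s, ω⟩
      simp [and_comm]
    refine MeasurableSet.union h1 (MeasurableSet.diff ?_ hu)
    by_cases hy : (0 : V) = y
    · have : (0 : ι × Ω → V) ⁻¹' {y} = Set.univ := by ext; simp [hy]
      rw [this]
      exact MeasurableSet.univ
    · have : (0 : ι × Ω → V) ⁻¹' {y} = ∅ := by ext; simp [hy]
      rw [this]
      exact MeasurableSet.empty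
  · refine ((hη.approx n).finite_range.insert 0).subset ?_
    rintro _ ⟨⟨s, ω⟩, rfl⟩
    by_cases h : s ∈ I
    · simp [h]
    · simp [h]
  · rintro ⟨s, ω⟩
    by_cases h : s ∈ I
    · simpa [h] using hη.tendsto_approx ω
    · simpa [h] using tendsto_const_nhds

variable [Fact (0 ≤ T)]

theorem predictable_le_prod : 𝓕.predictable ≤ Prod.instMeasurableSpace :=
  measurableSpace_le_predictable_of_measurableSet
    (fun _ hA => (measurableSet_singleton _).prod (𝓕.le _ _ hA))
    fun _ _ hA => measurableSet_Ioi.prod (𝓕.le _ _ hA)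

variable [NormedAddCommGroup V]

theorem IsPredictableVersion.stronglyMeasurable {Φ : Set.Icc (0 : ℝ) T → Ω → V}
    {Z : Set.Icc (0 : ℝ) T → Lp V 2 P} (h : IsPredictableVersion 𝓕 Φ Z) :
    StronglyMeasurable (fun x : Set.Icc (0 : ℝ) T × Ω => Φ x.1 x.2) :=
  h.1.mono predictable_le_prod

theorem IsPredictableVersion.add {Φ Φ' : Set.Icc (0 : ℝ) T → Ω → V}
    {Z Z' : Set.Icc (0 : ℝ) T → Lp V 2 P} (h : IsPredictableVersion 𝓕 Φ Z)
    (h' : IsPredictableVersion 𝓕 Φ' Z') : IsPredictableVersion 𝓕 (Φ + Φ') (Z + Z') := by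
  refine ⟨StronglyMeasurable.add h.1 h'.1, fun s => ?_⟩
  filter_upwards [h.2 s, h'.2 s, Lp.coeFn_add (Z s) (Z' s)] with ω h1 h2 h3
  simp only [Pi.add_apply] at *
  rw [h1, h2, h3]

theorem IsPredictableVersion.const_smul [NormedSpace ℝ V] {Φ : Set.Icc (0 : ℝ) T → Ω → V}
    {Z : Set.Icc (0 : ℝ) T → Lp V 2 P} (h : IsPredictableVersion 𝓕 Φ Z) (c : ℝ) :
    IsPredictableVersion 𝓕 (c • Φ) (c • Z) := by
  refine ⟨StronglyMeasurable.const_smul h.1 c, fun s => ?_⟩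
  filter_upwards [h.2 s, Lp.coeFn_smul c (Z s)] with ω h1 h3
  simp only [Pi.smul_apply] at *
  rw [h1, h3]

variable [SFinite P]

/-- Tonelli, available because predictability gives joint measurability. The right side involves
only `Z`, so bounds on integrals do not depend on the version. -/
theorem IsPredictableVersion.eLpNorm_sq {Φ : Set.Icc (0 : ℝ) T → Ω → V}
    {Z : Set.Icc (0 : ℝ) T → Lp V 2 P} (h : IsPredictableVersion 𝓕 Φ Z) :
    eLpNorm (fun x : Set.Icc (0 : ℝ) T × Ω => Φ x.1 x.2) 2 ((timeMeasure T).prod P) ^ 2 =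
      ∫⁻ s, ‖Z s‖ₑ ^ 2 ∂(timeMeasure T) := by
  rw [eLpNorm_two_sq, lintegral_prod _ (h.stronglyMeasurable.enorm.pow_const 2).aemeasurable]
  refine lintegral_congr fun s => ?_
  rw [Lp.enorm_sq_eq_lintegral]
  refine lintegral_congr_ae ?_
  filter_upwards [h.2 s] with ω hω
  rw [hω]

theorem IsPredictableVersion.memLp {Φ : Set.Icc (0 : ℝ) T → Ω → V}
    {Z : Set.Icc (0 : ℝ) T → Lp V 2 P} (h : IsPredictableVersion 𝓕 Φ Z)
    (hZ : ∫⁻ s, ‖Z s‖ₑ ^ 2 ∂(timeMeasure T) ≠ ∞) :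
    MemLp (fun x : Set.Icc (0 : ℝ) T × Ω => Φ x.1 x.2) 2 ((timeMeasure T).prod P) := by
  refine ⟨h.stronglyMeasurable.aestronglyMeasurable, lt_top_iff_ne_top.2 fun htop => hZ ?_⟩
  rw [← h.eLpNorm_sq, htop]
  simp

end Predictable

/-! ### Left-point step processes and the construction of predictable versions -/

section StepApproximation

variable {T : ℝ} [Fact (0 ≤ T)]

/-- A partition of `[0, t]` along which a continuous function oscillates by less than `ε`. -/
theorem exists_partition_dist_lt {M : Type*} [PseudoMetricSpace M]
    (z : C(Set.Icc (0 : ℝ) T, M)) (t : Set.Icc (0 : ℝ) T) {ε : ℝ} (hε : 0 < ε) :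
    ∃ (N : ℕ) (g : ℕ → Set.Icc (0 : ℝ) T), Monotone g ∧ g 0 = ⊥ ∧ g N = t ∧ (∀ n, g n ≤ t) ∧
      ∀ n, ∀ s ∈ Set.Ioc (g n) (g (n + 1)), dist (z (g n)) (z s) < ε := by
  obtain ⟨g, h0, hg, ⟨N, hN⟩, hc⟩ := exists_monotone_Icc_subset_open_cover_Icc (Fact.out : 0 ≤ T)
    (c := fun i : Set.Icc (0 : ℝ) T => z ⁻¹' Metric.ball (z i) (ε / 2))
    (fun i => Metric.isOpen_ball.preimage z.continuous)
    fun s _ => Set.mem_iUnion.2 ⟨s, by simpa using hε⟩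
  -- Truncating a partition of `[0, T]` at `t` only creates empty intervals beyond `t`, where the
  -- oscillation bound is vacuous.
  refine ⟨N, fun n => g n ⊓ t, fun m n h => inf_le_inf_right t (hg h), ?_, ?_,
    fun n => inf_le_right, fun n s hs => ?_⟩
  · have : g 0 = ⊥ := Subtype.ext h0
    simp [this]
  · have : g N = ⊤ := Subtype.ext (hN N le_rfl)
    simp [this]
  · have hst : s ≤ t := hs.2.trans inf_le_right
    have hgt : g n ≤ t := by
      by_contra! h
      have h1 : g n ⊓ t = t := inf_eq_right.2 h.le
      exact absurd (h1 ▸ hs.1 : t < s) (not_lt.2 hst)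
    obtain ⟨i, hi⟩ := hc n
    have e : g n ⊓ t = g n := inf_eq_left.2 hgt
    have h1 := hi (Set.left_mem_Icc.2 (hg n.le_succ))
    have h2 := hi (Set.mem_Icc.2 ⟨(e ▸ hs.1 : g n < s).le, hs.2.trans inf_le_left⟩)
    simp only [Set.mem_preimage, Metric.mem_ball] at h1 h2
    simp only [e]
    calc dist (z (g n)) (z s) ≤ dist (z (g n)) (z i) + dist (z s) (z i) := dist_triangle_right _ _ _
      _ < ε := by linarith

variable {Ω : Type*} {mΩ : MeasurableSpace Ω}
  {𝓕 : Filtration (Set.Icc (0 : ℝ) T) mΩ} {P : Measure Ω}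
  {V : Type*} [NormedAddCommGroup V]

/-- The left-point step process `∑ k < N, 1_{(gₖ, gₖ₊₁]}(s) η(gₖ)`. -/
noncomputable def stepApprox (η : Set.Icc (0 : ℝ) T → Ω → V) (g : ℕ → Set.Icc (0 : ℝ) T) (N : ℕ)
    (s : Set.Icc (0 : ℝ) T) (ω : Ω) : V :=
  ∑ k ∈ Finset.range N, (Set.Ioc (g k) (g (k + 1))).indicator (fun _ => η (g k) ω) s

theorem stepApprox_of_mem {η : Set.Icc (0 : ℝ) T → Ω → V} {g : ℕ → Set.Icc (0 : ℝ) T}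
    (hg : Monotone g) {N n : ℕ} (hn : n < N) {s : Set.Icc (0 : ℝ) T}
    (hs : s ∈ Set.Ioc (g n) (g (n + 1))) (ω : Ω) : stepApprox η g N s ω = η (g n) ω := by
  rw [stepApprox, Finset.sum_eq_single_of_mem n (Finset.mem_range.2 hn), Set.indicator_of_mem hs]
  intro k _ hkn
  refine Set.indicator_of_notMem (fun hk => ?_) _
  rcases lt_or_gt_of_ne hkn with h | h
  · exact absurd (hk.2.trans (hg h)) (not_le.2 hs.1)
  · exact absurd (hs.2.trans (hg h)) (not_le.2 hk.1)

theorem stepApprox_of_lt {η : Set.Icc (0 : ℝ) T → Ω → V} {g : ℕ → Set.Icc (0 : ℝ) T}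
    {t : Set.Icc (0 : ℝ) T} (hg : ∀ n, g n ≤ t) (N : ℕ) {s : Set.Icc (0 : ℝ) T} (hs : t < s)
    (ω : Ω) : stepApprox η g N s ω = 0 :=
  Finset.sum_eq_zero fun _ _ =>
    Set.indicator_of_notMem (fun hk => absurd (hk.2.trans (hg _)) (not_le.2 hs)) _

theorem stepApprox_bot (η : Set.Icc (0 : ℝ) T → Ω → V) (g : ℕ → Set.Icc (0 : ℝ) T) (N : ℕ)
    (ω : Ω) : stepApprox η g N ⊥ ω = 0 :=
  Finset.sum_eq_zero fun _ _ =>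
    Set.indicator_of_notMem (fun hk => absurd hk.1 not_lt_bot) _

theorem exists_mem_Ioc_partition {g : ℕ → Set.Icc (0 : ℝ) T} {N : ℕ} {s : Set.Icc (0 : ℝ) T}
    (h0 : g 0 < s) (hN : s ≤ g N) : ∃ n < N, s ∈ Set.Ioc (g n) (g (n + 1)) := by
  classical
  have hex : ∃ n, s ≤ g n := ⟨N, hN⟩
  have h1 : Nat.find hex ≠ 0 := fun h => absurd (h ▸ Nat.find_spec hex) (not_le.2 h0)
  obtain ⟨m, hm⟩ := Nat.exists_eq_succ_of_ne_zero h1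
  refine ⟨m, ?_, ?_, (Nat.find_spec hex).trans_eq (congrArg g hm)⟩
  · have := Nat.find_min' hex hN
    omega
  · exact not_le.1 (Nat.find_min hex (by omega : m < Nat.find hex))

theorem isStronglyPredictable_stepApprox {η : Set.Icc (0 : ℝ) T → Ω → V}
    (hη : ∀ s, StronglyMeasurable[𝓕 s] (η s)) (g : ℕ → Set.Icc (0 : ℝ) T) (N : ℕ) :
    IsStronglyPredictable 𝓕 (stepApprox η g N) := by
  have h : Function.uncurry (stepApprox η g N) = fun x => ∑ k ∈ Finset.range N,
      (Function.uncurry fun s ω => (Set.Ioc (g k) (g (k + 1))).indicator (fun _ => η (g k) ω) s)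
        x := rfl
  unfold IsStronglyPredictable
  rw [h]
  exact Finset.stronglyMeasurable_fun_sum _ fun k _ => stronglyMeasurable_uncurry_indicator
    (fun A hA => measurableSet_predictable_Ioc_prod _ _ hA) (hη (g k))

variable [NormedSpace ℝ V]

/-- The random variables of an adapted family of `L²` classes have adapted representatives. -/
theorem AdaptedC.exists_representative (z : AdaptedC 𝓕 P V) :
    ∃ η : Set.Icc (0 : ℝ) T → Ω → V, (∀ s, StronglyMeasurable[𝓕 s] (η s)) ∧
      ∀ s, η s =ᵐ[P] z.1 s := by
  have h : ∀ s, AEStronglyMeasurable[𝓕 s] (z.1 s) P := fun s =>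
    mem_lpMeas_iff_aestronglyMeasurable.1 (z.2 s)
  exact ⟨fun s => (h s).mk _, fun s => (h s).stronglyMeasurable_mk, fun s => (h s).ae_eq_mk.symm⟩

/-- Continuous adapted processes, cut off at `t`, are uniform limits of step processes. -/
theorem AdaptedC.exists_stepApprox (z : AdaptedC 𝓕 P V) (t : Set.Icc (0 : ℝ) T)
    {η : Set.Icc (0 : ℝ) T → Ω → V} (hη : ∀ s, η s =ᵐ[P] z.1 s) {ε : ℝ≥0∞} (hε : ε ≠ 0) :
    ∃ (N : ℕ) (g : ℕ → Set.Icc (0 : ℝ) T), Monotone g ∧ (∀ n, g n ≤ t) ∧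
      ∀ s ≠ ⊥, eLpNorm (stepApprox η g N s - ⇑((Set.Iic t).indicator z.1 s)) 2 P ≤ ε := by
  obtain ⟨δ, hδ, hδε⟩ : ∃ δ : ℝ, 0 < δ ∧ ENNReal.ofReal δ ≤ ε := by
    obtain ⟨δ, h1, h2⟩ := ENNReal.lt_iff_exists_nnreal_btwn.1 (pos_iff_ne_zero.2 hε)
    exact ⟨δ, by exact_mod_cast h1, by simpa using h2.le⟩
  obtain ⟨N, g, hg, h0, hN, hgt, hd⟩ := exists_partition_dist_lt z.1 t hδ
  refine ⟨N, g, hg, hgt, fun s hs => ?_⟩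
  rcases le_or_gt s t with hst | hst
  · obtain ⟨n, hn, hsn⟩ := exists_mem_Ioc_partition (h0 ▸ bot_lt_iff_ne_bot.2 hs) (hN ▸ hst)
    have h1 : (stepApprox η g N s - ⇑((Set.Iic t).indicator z.1 s)) =ᵐ[P]
        ⇑(z.1 (g n)) - ⇑(z.1 s) := by
      rw [Set.indicator_of_mem (Set.mem_Iic.2 hst)]
      filter_upwards [hη (g n)] with ω hω
      rw [Pi.sub_apply, Pi.sub_apply, stepApprox_of_mem hg hn hsn, hω]
    rw [eLpNorm_congr_ae h1, ← Lp.edist_def, edist_dist]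
    exact (ENNReal.ofReal_le_ofReal (hd n s hsn).le).trans hδε
  · have h1 : (stepApprox η g N s - ⇑((Set.Iic t).indicator z.1 s)) =ᵐ[P] 0 := by
      rw [Set.indicator_of_notMem (fun h => absurd (Set.mem_Iic.1 h) (not_le.2 hst))]
      filter_upwards [Lp.coeFn_zero V 2 P] with ω hω
      rw [Pi.sub_apply, stepApprox_of_lt hgt N hst, hω]
      simp
    rw [eLpNorm_congr_ae h1]
    simp

variable [CompleteSpace V] [IsProbabilityMeasure P]

/-- Continuous adapted processes, cut off at `t`, have predictable versions. -/
theorem AdaptedC.exists_isPredictableVersion (z : AdaptedC 𝓕 P V) (t : Set.Icc (0 : ℝ) T) :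
    ∃ Φ : Set.Icc (0 : ℝ) T → Ω → V, IsPredictableVersion 𝓕 Φ ((Set.Iic t).indicator z.1) ∧
      ∀ s, t < s → Φ s = 0 := by
  obtain ⟨η, hηm, hη⟩ := z.exists_representative
  -- Geometric errors are summable, so the step processes converge almost surely at each fixed time,
  -- without passing to a subsequence.
  have hε : ∀ n : ℕ, (2⁻¹ : ℝ≥0∞) ^ n ≠ 0 := fun n => pow_ne_zero _ (by simp)
  choose N g hg hgt hd using fun n => z.exists_stepApprox t hη (hε n)
  -- Intervals open on the left miss time zero, so the initial value is added separately; `{⊥} × A`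
  -- with `A ∈ 𝓕 ⊥` is predictable.
  let ζ : ℕ → Set.Icc (0 : ℝ) T → Ω → V := fun n s ω =>
    ({⊥} : Set (Set.Icc (0 : ℝ) T)).indicator (fun _ => η ⊥ ω) s + stepApprox η (g n) (N n) s ω
  have hζ0 : ∀ n s, s ≠ ⊥ → ζ n s = stepApprox η (g n) (N n) s := fun n s hs => by
    ext ω
    simp [ζ, hs]
  have hζp : ∀ n, StronglyMeasurable[𝓕.predictable] (Function.uncurry (ζ n)) := fun n =>
    StronglyMeasurable.add
      (stronglyMeasurable_uncurry_indicator
        (fun A hA => measurableSet_predictable_singleton_bot_prod hA) (hηm ⊥))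
      (isStronglyPredictable_stepApprox hηm (g n) (N n))
  -- `limUnder` is predictable as a function of `(s, ω)` whether or not the limit exists. For every
  -- `s` the limit exists almost surely and represents the given class.
  refine ⟨fun s ω => limUnder atTop fun n => ζ n s ω, ⟨?_, fun s => ?_⟩, fun s hs => ?_⟩
  · exact @StronglyMeasurable.limUnder _ _ _ 𝓕.predictable _ _ _ _ _ _ _ hζp
  · have key : ∀ᵐ ω ∂P, Tendsto (fun n => ζ n s ω) atTop
        (𝓝 ((Set.Iic t).indicator z.1 s ω)) := by
      by_cases hs : s = ⊥
      · subst hs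
        rw [Set.indicator_of_mem (Set.mem_Iic.2 bot_le)]
        filter_upwards [hη ⊥] with ω hω
        simp [ζ, stepApprox_bot, hω]
      · refine ae_tendsto_of_eLpNorm_le (b := fun n => 2⁻¹ ^ n) (fun n => ?_)
          (Lp.aestronglyMeasurable _) ?_ fun n => ?_
        · exact (((hζp n).mono predictable_le_prod).comp_measurable
            measurable_prodMk_left).aestronglyMeasurable
        · rw [ENNReal.tsum_geometric]
          simp
        · rw [hζ0 n s hs]
          exact hd n s hs
    filter_upwards [key] with ω hω
    exact hω.limUnder_eq
  · ext ω
    have : ∀ n, ζ n s ω = 0 := fun n => by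
      rw [hζ0 n s (bot_le.trans_lt hs).ne', stepApprox_of_lt (hgt n) _ hs]
    simp only [this]
    exact tendsto_const_nhds.limUnder_eq

end StepApproximation

/-! ### Approximation of predictable versions by indicators of predictable rectangles -/

theorem enorm_sq_le_ofReal_iff {V : Type*} [SeminormedAddCommGroup V] {x : V} {a : ℝ}
    (ha : 0 ≤ a) : ‖x‖ₑ ^ 2 ≤ ENNReal.ofReal a ↔ ‖x‖ ^ 2 ≤ a := by
  rw [← ofReal_norm, ← ENNReal.ofReal_pow (norm_nonneg x), ENNReal.ofReal_le_ofReal_iff ha]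

section Rectangles

variable {α Ω : Type*} {mα : MeasurableSpace α} {mΩ : MeasurableSpace Ω} {μ : Measure α}
  {P : Measure Ω} {V : Type*} [NormedAddCommGroup V] [NormedSpace ℝ V]

/-- `v ↦ 1_s v` as a continuous linear map. -/
noncomputable def indicatorConstLpL (V : Type*) [NormedAddCommGroup V] [NormedSpace ℝ V]
    {s : Set α} (hs : MeasurableSet s) (hμs : μ s ≠ ∞) : V →L[ℝ] Lp V 2 μ :=
  LinearMap.mkContinuous
    { toFun := fun v => indicatorConstLp 2 hs hμs v
      map_add' := fun _ _ => indicatorConstLp_add.symm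
      map_smul' := fun c v => by
        ext1
        filter_upwards [indicatorConstLp_coeFn (p := 2) (hs := hs) (hμs := hμs) (c := c • v),
          indicatorConstLp_coeFn (p := 2) (hs := hs) (hμs := hμs) (c := v),
          Lp.coeFn_smul c (indicatorConstLp 2 hs hμs v)] with x h1 h2 h3
        rw [RingHom.id_apply, h1, h3, Pi.smul_apply, h2]
        by_cases h : x ∈ s <;> simp [h] }
    (μ.real s ^ (1 / (2 : ℝ≥0∞).toReal)) fun v => by
      rw [mul_comm]
      exact norm_indicatorConstLp_le (hs := hs) (hμs := hμs)

variable [IsFiniteMeasure μ] [SFinite P]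

theorem memLp_indicator_comp_snd {I : Set α} (hI : MeasurableSet I) {η : Ω → V}
    (hη : MemLp η 2 P) :
    MemLp ((I ×ˢ (Set.univ : Set Ω)).indicator fun x => η x.2) 2 (μ.prod P) :=
  (hη.comp_snd μ).indicator (hI.prod MeasurableSet.univ)

theorem eLpNorm_indicator_comp_snd_sq_le (I : Set α) {η : Ω → V} (hη : AEStronglyMeasurable η P) :
    eLpNorm ((I ×ˢ (Set.univ : Set Ω)).indicator fun x => η x.2) 2 (μ.prod P) ^ 2 ≤
      μ Set.univ * eLpNorm η 2 P ^ 2 := by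
  refine (pow_le_pow_left' (eLpNorm_indicator_le _) 2).trans ?_
  rw [eLpNorm_two_sq, eLpNorm_two_sq, lintegral_prod _ (hη.comp_snd.enorm.pow_const 2)]
  simp only [lintegral_const]
  rw [mul_comm]

/-- `η ↦ 1_I ⊗ η` as a continuous linear map. -/
noncomputable def indicatorTensorL (V : Type*) [NormedAddCommGroup V] [NormedSpace ℝ V]
    (μ : Measure α) [IsFiniteMeasure μ] (P : Measure Ω) [SFinite P] {I : Set α}
    (hI : MeasurableSet I) : Lp V 2 P →L[ℝ] Lp V 2 (μ.prod P) :=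
  LinearMap.mkContinuous
    { toFun := fun η => (memLp_indicator_comp_snd hI (Lp.memLp η)).toLp _
      map_add' := fun η η' => by
        rw [← MemLp.toLp_add]
        refine MemLp.toLp_congr _ _ ?_
        filter_upwards [Measure.quasiMeasurePreserving_snd.ae (Lp.coeFn_add η η')] with x hx
        by_cases h : x ∈ I ×ˢ (Set.univ : Set Ω)
        · rw [Pi.add_apply] at hx
          simp only [Pi.add_apply, Set.indicator_of_mem h]
          exact hx
        · simp [h]
      map_smul' := fun c η => by
        rw [RingHom.id_apply, ← MemLp.toLp_const_smul]
        refine MemLp.toLp_congr _ _ ?_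
        filter_upwards [Measure.quasiMeasurePreserving_snd.ae (Lp.coeFn_smul c η)] with x hx
        by_cases h : x ∈ I ×ˢ (Set.univ : Set Ω)
        · rw [Pi.smul_apply] at hx
          simp only [Pi.smul_apply, Set.indicator_of_mem h]
          exact hx
        · simp [h] }
    (√(μ.real Set.univ)) fun η => by
      refine (sq_le_sq₀ (norm_nonneg _) (by positivity)).1 ?_
      rw [mul_pow, Real.sq_sqrt measureReal_nonneg, ← enorm_sq_le_ofReal_iff (by positivity),
        ENNReal.ofReal_mul measureReal_nonneg, ofReal_measureReal, ENNReal.ofReal_pow (by simp),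
        ofReal_norm, Lp.enorm_def η]
      refine (congrArg (· ^ 2) (Lp.enorm_toLp
        (memLp_indicator_comp_snd hI (Lp.memLp η)))).trans_le ?_
      exact eLpNorm_indicator_comp_snd_sq_le I (Lp.aestronglyMeasurable η)

theorem coeFn_indicatorTensorL {I : Set α} (hI : MeasurableSet I) (η : Lp V 2 P) :
    indicatorTensorL V μ P hI η =ᵐ[μ.prod P]
      (I ×ˢ (Set.univ : Set Ω)).indicator fun x => η x.2 :=
  MemLp.coeFn_toLp (memLp_indicator_comp_snd hI (Lp.memLp η))

end Rectangles

section Approximation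

variable {T : ℝ} [Fact (0 ≤ T)] {Ω : Type*} {mΩ : MeasurableSpace Ω}
  {𝓕 : Filtration (Set.Icc (0 : ℝ) T) mΩ} {P : Measure Ω} [IsProbabilityMeasure P]
  {V : Type*} [NormedAddCommGroup V] [NormedSpace ℝ V]

theorem measurableSet_Ioc_prod {a b : Set.Icc (0 : ℝ) T} {A : Set Ω}
    (hA : MeasurableSet[𝓕 a] A) : MeasurableSet (Set.Ioc a b ×ˢ A) :=
  measurableSet_Ioc.prod (𝓕.le a _ hA)

/-- The closed subspace `M` of `L²([0, T] × Ω)` contains the indicators of the predictable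
rectangles before time `t`. -/
def ContainsRectangles (𝓕 : Filtration (Set.Icc (0 : ℝ) T) mΩ)
    (M : Submodule ℝ (Lp V 2 ((timeMeasure T).prod P))) (t : Set.Icc (0 : ℝ) T) : Prop :=
  ∀ (a b : Set.Icc (0 : ℝ) T), a ≤ b → b ≤ t → ∀ (A : Set Ω) (hA : MeasurableSet[𝓕 a] A) (v : V),
    indicatorConstLp 2 (measurableSet_Ioc_prod (b := b) hA) (measure_ne_top _ _) v ∈ M

variable {M : Submodule ℝ (Lp V 2 ((timeMeasure T).prod P))} {t : Set.Icc (0 : ℝ) T}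

/-- Indicators of events in `𝓕 a` give rectangles; sums and `L²` limits then reach every `𝓕
a`-measurable `η`, since the tensor map is continuous and `M` is closed. -/
theorem ContainsRectangles.indicatorTensorL_mem (h : ContainsRectangles 𝓕 M t)
    (hM : IsClosed (M : Set (Lp V 2 ((timeMeasure T).prod P)))) {a b : Set.Icc (0 : ℝ) T}
    (hab : a ≤ b) (hbt : b ≤ t) (η : Lp V 2 P) (hη : AEStronglyMeasurable[𝓕 a] η P) :
    indicatorTensorL V (timeMeasure T) P (measurableSet_Ioc (a := a) (b := b)) η ∈ M := by
  refine Lp.induction_stronglyMeasurable (𝓕.le a) (by simp) (fun η => indicatorTensorL V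
    (timeMeasure T) P (measurableSet_Ioc (a := a) (b := b)) η ∈ M) ?_ ?_ ?_ η hη
  · intro v A hA hPA
    convert h a b hab hbt A hA v using 1
    ext1
    have h1 : ∀ᵐ x ∂((timeMeasure T).prod P), (Lp.simpleFunc.indicatorConst 2 (𝓕.le a A hA) hPA.ne v
        : Lp V 2 P) x.2 = A.indicator (fun _ => v) x.2 :=
      Measure.quasiMeasurePreserving_snd.ae
        (indicatorConstLp_coeFn (p := 2) (hs := 𝓕.le a A hA) (hμs := hPA.ne) (c := v))
    filter_upwards [coeFn_indicatorTensorL (measurableSet_Ioc (a := a) (b := b))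
      (Lp.simpleFunc.indicatorConst 2 (𝓕.le a A hA) hPA.ne v : Lp V 2 P),
      indicatorConstLp_coeFn (p := 2) (hs := measurableSet_Ioc_prod (b := b) hA)
        (hμs := measure_ne_top ((timeMeasure T).prod P) _) (c := v), h1] with x e1 e2 e3
    rw [e1, e2]
    by_cases hx : x.1 ∈ Set.Ioc a b <;> by_cases hx' : x.2 ∈ A
    all_goals simp only [Set.indicator, Set.mem_prod, hx, hx', Set.mem_univ, and_self, and_true,
      and_false, if_true, if_false, e3]
  · intro f g hf hg _ _ _ h1 h2
    rw [map_add]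
    exact M.add_mem h1 h2
  · exact hM.preimage ((indicatorTensorL V _ P _).continuous.comp continuous_subtype_val)

theorem ContainsRectangles.stepApprox_mem (h : ContainsRectangles 𝓕 M t)
    (hM : IsClosed (M : Set (Lp V 2 ((timeMeasure T).prod P)))) {z : AdaptedC 𝓕 P V}
    {η : Set.Icc (0 : ℝ) T → Ω → V} (hη : ∀ s, η s =ᵐ[P] z.1 s) {g : ℕ → Set.Icc (0 : ℝ) T}
    (hg : Monotone g) (hgt : ∀ n, g n ≤ t) (N : ℕ) :
    ∃ y ∈ M, y =ᵐ[(timeMeasure T).prod P] fun x => stepApprox η g N x.1 x.2 := by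
  refine ⟨∑ k ∈ Finset.range N, indicatorTensorL V (timeMeasure T) P
    (measurableSet_Ioc (a := g k) (b := g (k + 1))) (z.1 (g k)), Submodule.sum_mem _ fun k _ =>
      h.indicatorTensorL_mem hM (hg k.le_succ) (hgt _) _
        (mem_lpMeas_iff_aestronglyMeasurable.1 (z.2 _)), ?_⟩
  induction N with
  | zero =>
    filter_upwards [Lp.coeFn_zero V 2 ((timeMeasure T).prod P)] with x hx
    simpa [stepApprox] using hx
  | succ N ih =>
    rw [Finset.sum_range_succ]
    filter_upwards [ih, Lp.coeFn_add (∑ k ∈ Finset.range N, indicatorTensorL V (timeMeasure T) P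
      (measurableSet_Ioc (a := g k) (b := g (k + 1))) (z.1 (g k))) (indicatorTensorL V
      (timeMeasure T) P (measurableSet_Ioc (a := g N) (b := g (N + 1))) (z.1 (g N))),
      coeFn_indicatorTensorL (P := P) (measurableSet_Ioc (a := g N) (b := g (N + 1))) (z.1 (g N)),
      Measure.quasiMeasurePreserving_snd.ae (hη (g N))] with x h1 h2 h3 h4
    rw [h2, Pi.add_apply, h1, h3, stepApprox, stepApprox, Finset.sum_range_succ]
    congr 1
    by_cases hx : x.1 ∈ Set.Ioc (g N) (g (N + 1))
    · rw [Set.indicator_of_mem (Set.mem_prod.2 ⟨hx, Set.mem_univ _⟩), Set.indicator_of_mem hx, h4]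
    · rw [Set.indicator_of_notMem (fun h => hx h.1), Set.indicator_of_notMem hx]

/-- Predictable versions of continuous adapted processes, cut off at `t`, are limits in
`L²([0, T] × Ω)` of linear combinations of indicators of predictable rectangles before `t`. -/
theorem ContainsRectangles.toLp_mem (h : ContainsRectangles 𝓕 M t)
    (hM : IsClosed (M : Set (Lp V 2 ((timeMeasure T).prod P)))) {z : AdaptedC 𝓕 P V}
    {Φ : Set.Icc (0 : ℝ) T → Ω → V} (hΦ : IsPredictableVersion 𝓕 Φ ((Set.Iic t).indicator z.1))
    (hΦ2 : MemLp (fun x : Set.Icc (0 : ℝ) T × Ω => Φ x.1 x.2) 2 ((timeMeasure T).prod P)) :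
    hΦ2.toLp _ ∈ M := by
  obtain ⟨η, hηm, hη⟩ := z.exists_representative
  rw [← SetLike.mem_coe, ← hM.closure_eq, EMetric.mem_closure_iff]
  intro ε hε
  -- A uniform error `δ` in `L²(Ω)` costs at most `T δ ^ 2` in squared norm on the product space.
  obtain ⟨δ, hδ, hδε⟩ : ∃ δ : ℝ≥0∞, δ ≠ 0 ∧ timeMeasure T Set.univ * δ ^ 2 < ε ^ 2 := by
    have h1 : Tendsto (fun n : ℕ => timeMeasure T Set.univ * ((n : ℝ≥0∞)⁻¹) ^ 2) atTop (𝓝 0) := by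
      have := ENNReal.Tendsto.const_mul (a := timeMeasure T Set.univ)
        (ENNReal.Tendsto.pow (n := 2) ENNReal.tendsto_inv_nat_nhds_zero) (Or.inr (measure_ne_top _ _))
      simpa using this
    obtain ⟨n, hn⟩ := (h1.eventually_lt_const
      (pos_iff_ne_zero.2 (pow_ne_zero 2 hε.ne'))).exists
    exact ⟨(n : ℝ≥0∞)⁻¹, by simp, hn⟩
  obtain ⟨N, g, hg, hgt, hd⟩ := z.exists_stepApprox t hη hδ
  obtain ⟨y, hy, hy'⟩ := h.stepApprox_mem hM hη hg hgt N
  refine ⟨y, hy, ?_⟩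
  refine lt_of_not_ge fun hle => absurd (pow_le_pow_left' hle 2) (not_le.2 (lt_of_le_of_lt ?_ hδε))
  have hstep : StronglyMeasurable fun x : Set.Icc (0 : ℝ) T × Ω => stepApprox η g N x.1 x.2 :=
    (isStronglyPredictable_stepApprox hηm g N).mono predictable_le_prod
  rw [edist_comm, Lp.edist_def, eLpNorm_two_sq]
  have h1 : ∫⁻ x, ‖(⇑y - ⇑(hΦ2.toLp _)) x‖ₑ ^ 2 ∂((timeMeasure T).prod P) =
      ∫⁻ x, ‖stepApprox η g N x.1 x.2 - Φ x.1 x.2‖ₑ ^ 2 ∂((timeMeasure T).prod P) := by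
    refine lintegral_congr_ae ?_
    filter_upwards [hy', hΦ2.coeFn_toLp] with x e1 e2
    rw [Pi.sub_apply, e1, e2]
  rw [h1, lintegral_prod (fun x => ‖stepApprox η g N x.1 x.2 - Φ x.1 x.2‖ₑ ^ 2)
    ((hstep.sub hΦ.stronglyMeasurable).enorm.pow_const 2).aemeasurable,
    mul_comm, ← lintegral_const]
  refine lintegral_mono_ae ?_
  have hbot : ∀ᵐ s ∂(timeMeasure T), s ≠ ⊥ := Measure.ae_ne _ _
  filter_upwards [hbot] with s hs
  refine le_trans (le_of_eq ?_) (pow_le_pow_left' (hd s hs) 2)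
  rw [eLpNorm_two_sq]
  refine lintegral_congr_ae ?_
  filter_upwards [hΦ.2 s] with ω hω
  rw [Pi.sub_apply, ← hω]

end Approximation

/-! ### The Itô isometry -/

theorem Lp.coeFn_finset_sum {α ι V : Type*} {mα : MeasurableSpace α} {μ : Measure α}
    [NormedAddCommGroup V] (s : Finset ι) (f : ι → Lp V 2 μ) :
    ⇑(∑ i ∈ s, f i) =ᵐ[μ] fun x => ∑ i ∈ s, f i x := by
  classical
  induction s using Finset.induction_on with
  | empty =>
    filter_upwards [Lp.coeFn_zero V 2 μ] with x hx
    simpa using hx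
  | insert i s hi ih =>
    rw [Finset.sum_insert hi]
    filter_upwards [ih, Lp.coeFn_add (f i) (∑ i ∈ s, f i)] with x h1 h2
    rw [h2, Pi.add_apply, h1, Finset.sum_insert hi]

section Isometry

variable {T : ℝ} [Fact (0 ≤ T)] {Ω : Type*} {mΩ : MeasurableSpace Ω}
  {𝓕 : Filtration (Set.Icc (0 : ℝ) T) mΩ} {P : Measure Ω} [IsProbabilityMeasure P]
  {U H : Type*} [NormedAddCommGroup U] [InnerProductSpace ℝ U] [CompleteSpace U]
  [NormedAddCommGroup H] [InnerProductSpace ℝ H] [CompleteSpace H]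

namespace CylindricalBM

variable (W : CylindricalBM 𝓕 P U)

theorem memLp_indicator_smul (f : Lp U 2 (timeMeasure T)) {a : Set.Icc (0 : ℝ) T} {A : Set Ω}
    (hA : MeasurableSet[𝓕 a] A) (h : H) :
    MemLp (A.indicator fun ω => W.toIsometry f ω • h) 2 P :=
  (((ContinuousLinearMap.toSpanSingleton ℝ h).comp_memLp (W.toIsometry f)).indicator
    (𝓕.le a _ hA))

/-- The `L²` class of `1_{(a, b] × A} (h ⊗ u)`. -/
noncomputable def rectangle (P : Measure Ω) [IsProbabilityMeasure P] {a b : Set.Icc (0 : ℝ) T}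
    {A : Set Ω} (hA : MeasurableSet[𝓕 a] A) (u : U) (h : H) :
    Lp (HilbertSchmidt U H) 2 ((timeMeasure T).prod P) :=
  indicatorConstLp 2 (measurableSet_Ioc_prod (b := b) hA) (measure_ne_top _ _)
    (HilbertSchmidt.rankOne h u)

/-- The `L²` class of `1_A W(1_{(a, b]} u) h`. -/
noncomputable def rectangleIntegral (a b : Set.Icc (0 : ℝ) T) {A : Set Ω}
    (hA : MeasurableSet[𝓕 a] A) (u : U) (h : H) : Lp H 2 P :=
  (W.memLp_indicator_smul (stepL2 a b u) hA h).toLp _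

/-- Both sides factor into the length of the common interval, the probability of `A ∩ A'`, and the
inner products in `U` and `H`. The two-rectangle form is what bilinearity extends to sums, whose
rectangles may overlap. -/
theorem inner_rectangleIntegral {a b a' b' : Set.Icc (0 : ℝ) T} (hab : a ≤ b) (hab' : a' ≤ b')
    {A A' : Set Ω} (hA : MeasurableSet[𝓕 a] A) (hA' : MeasurableSet[𝓕 a'] A') (u u' : U)
    (h h' : H) :
    inner ℝ (rectangle P (b := b) hA u h) (rectangle P (b := b') hA' u' h') =
      inner ℝ (W.rectangleIntegral a b hA u h) (W.rectangleIntegral a' b' hA' u' h') := by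
  rw [rectangle, rectangle, L2.inner_indicatorConstLp_indicatorConstLp, Set.prod_inter_prod,
    measureReal_prod_prod, HilbertSchmidt.inner_rankOne, L2.inner_def]
  have h1 : ∫ ω, inner ℝ (W.rectangleIntegral a b hA u h ω)
      (W.rectangleIntegral a' b' hA' u' h' ω) ∂P =
      ∫ ω, (A ∩ A').indicator (fun ω => W.toIsometry (stepL2 a b u) ω *
        W.toIsometry (stepL2 a' b' u') ω) ω * inner ℝ h h' ∂P := by
    refine integral_congr_ae ?_
    filter_upwards [(W.memLp_indicator_smul (stepL2 a b u) hA h).coeFn_toLp,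
      (W.memLp_indicator_smul (stepL2 a' b' u') hA' h').coeFn_toLp] with ω e1 e2
    rw [rectangleIntegral, rectangleIntegral, e1, e2]
    by_cases hω : ω ∈ A <;> by_cases hω' : ω ∈ A' <;>
      simp [hω, hω', inner_smul_left, inner_smul_right, mul_assoc, mul_left_comm]
  rw [h1, integral_mul_const, integral_indicator ((𝓕.le a _ hA).inter (𝓕.le a' _ hA')),
    W.setIntegral_inter_mul hab hab' u u' hA hA', smul_eq_mul]
  ring

/-- The pairs of indicators of predictable rectangles before `t` and of their Itô integrals. -/
noncomputable def rectanglePairs (H : Type*) [NormedAddCommGroup H] [InnerProductSpace ℝ H] [CompleteSpace H]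
    (t : Set.Icc (0 : ℝ) T) :
    Set (Lp (HilbertSchmidt U H) 2 ((timeMeasure T).prod P) × Lp H 2 P) :=
  {p | ∃ (a b : Set.Icc (0 : ℝ) T) (_ : a ≤ b) (_ : b ≤ t) (A : Set Ω) (hA : MeasurableSet[𝓕 a] A)
    (u : U) (h : H), p = (rectangle P (b := b) hA u h, W.rectangleIntegral a b hA u h)}

/-- The graph of the elementary Itô integral before `t`. -/
noncomputable def elementaryGraph (H : Type*) [NormedAddCommGroup H] [InnerProductSpace ℝ H] [CompleteSpace H]
    (t : Set.Icc (0 : ℝ) T) :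
    Submodule ℝ (Lp (HilbertSchmidt U H) 2 ((timeMeasure T).prod P) × Lp H 2 P) :=
  Submodule.span ℝ (W.rectanglePairs H t)

theorem elementaryGraph_mono {t t' : Set.Icc (0 : ℝ) T} (h : t ≤ t') :
    W.elementaryGraph H t ≤ W.elementaryGraph H t' := by
  refine Submodule.span_mono ?_
  rintro _ ⟨a, b, hab, hbt, A, hA, u, k, rfl⟩
  exact ⟨a, b, hab, hbt.trans h, A, hA, u, k, rfl⟩

/-- Bilinearity in both arguments. Spanning pairs, rather than extending a map linearly from
rectangles, requires no prior proof that the elementary integral is well defined. -/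
theorem inner_elementaryGraph {t : Set.Icc (0 : ℝ) T}
    {p q : Lp (HilbertSchmidt U H) 2 ((timeMeasure T).prod P) × Lp H 2 P}
    (hp : p ∈ W.elementaryGraph H t) (hq : q ∈ W.elementaryGraph H t) :
    inner ℝ p.1 q.1 = inner ℝ p.2 q.2 := by
  induction hp using Submodule.span_induction with
  | mem p hp =>
    induction hq using Submodule.span_induction with
    | mem q hq =>
      obtain ⟨a, b, hab, -, A, hA, u, h, rfl⟩ := hp
      obtain ⟨a', b', hab', -, A', hA', u', h', rfl⟩ := hq
      exact W.inner_rectangleIntegral hab hab' hA hA' u u' h h'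
    | zero => simp
    | add q q' _ _ h h' => simp only [Prod.fst_add, Prod.snd_add, inner_add_right, h, h']
    | smul c q _ h => simp only [Prod.smul_fst, Prod.smul_snd, inner_smul_right, h]
  | zero => simp
  | add p p' _ _ h h' => simp only [Prod.fst_add, Prod.snd_add, inner_add_left, h, h']
  | smul c p _ h => simp only [Prod.smul_fst, Prod.smul_snd, inner_smul_left, h]

theorem norm_elementaryGraph {t : Set.Icc (0 : ℝ) T}
    {p : Lp (HilbertSchmidt U H) 2 ((timeMeasure T).prod P) × Lp H 2 P}
    (hp : p ∈ W.elementaryGraph H t) : ‖p.1‖ = ‖p.2‖ := by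
  have h := W.inner_elementaryGraph hp hp
  rw [real_inner_self_eq_norm_sq, real_inner_self_eq_norm_sq] at h
  exact (sq_eq_sq₀ (norm_nonneg _) (norm_nonneg _)).1 h

/-- The graph of the Itô integral of integrands which vanish after `t`. -/
noncomputable def itoGraph (H : Type*) [NormedAddCommGroup H] [InnerProductSpace ℝ H] [CompleteSpace H]
    (t : Set.Icc (0 : ℝ) T) :
    Submodule ℝ (Lp (HilbertSchmidt U H) 2 ((timeMeasure T).prod P) × Lp H 2 P) :=
  (W.elementaryGraph H t).topologicalClosure

/-- The **Itô isometry**. -/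
theorem norm_itoGraph {t : Set.Icc (0 : ℝ) T}
    {p : Lp (HilbertSchmidt U H) 2 ((timeMeasure T).prod P) × Lp H 2 P}
    (hp : p ∈ W.itoGraph H t) : ‖p.1‖ = ‖p.2‖ := by
  have hc : IsClosed {p : Lp (HilbertSchmidt U H) 2 ((timeMeasure T).prod P) × Lp H 2 P |
      ‖p.1‖ = ‖p.2‖} := isClosed_eq (by fun_prop) (by fun_prop)
  exact closure_minimal (fun p hp => W.norm_elementaryGraph hp) hc hp

theorem itoGraph_mono {t t' : Set.Icc (0 : ℝ) T} (h : t ≤ t') :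
    W.itoGraph H t ≤ W.itoGraph H t' :=
  Submodule.topologicalClosure_mono (W.elementaryGraph_mono h)

theorem isClosed_itoGraph (t : Set.Icc (0 : ℝ) T) :
    IsClosed (W.itoGraph H t :
      Set (Lp (HilbertSchmidt U H) 2 ((timeMeasure T).prod P) × Lp H 2 P)) :=
  Submodule.isClosed_topologicalClosure _

/-- Itô integrals of integrands which vanish after `t` are `𝓕 t`-measurable. -/
theorem mem_lpMeas_of_mem_itoGraph {t : Set.Icc (0 : ℝ) T}
    {p : Lp (HilbertSchmidt U H) 2 ((timeMeasure T).prod P) × Lp H 2 P}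
    (hp : p ∈ W.itoGraph H t) : p.2 ∈ lpMeas H ℝ (𝓕 t) 2 P := by
  have hc : IsClosed ((lpMeas H ℝ (𝓕 t) 2 P : Submodule ℝ (Lp H 2 P)) : Set (Lp H 2 P)) :=
    isClosed_aestronglyMeasurable (𝓕.le t)
  have hc' : IsClosed (((lpMeas H ℝ (𝓕 t) 2 P).comap (LinearMap.snd ℝ
      (Lp (HilbertSchmidt U H) 2 ((timeMeasure T).prod P)) (Lp H 2 P)) : Submodule ℝ _) :
      Set (Lp (HilbertSchmidt U H) 2 ((timeMeasure T).prod P) × Lp H 2 P)) :=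
    hc.preimage continuous_snd
  refine Submodule.topologicalClosure_minimal _ (Submodule.span_le.2 ?_) hc' hp
  rintro _ ⟨a, b, hab, hbt, A, hA, u, h, rfl⟩
  change W.rectangleIntegral a b hA u h ∈ lpMeas H ℝ (𝓕 t) 2 P
  rw [mem_lpMeas_iff_aestronglyMeasurable]
  have h1 : AEStronglyMeasurable[𝓕 t] (fun ω => W.toIsometry (stepL2 a b u) ω • h) P :=
    (ContinuousLinearMap.toSpanSingleton ℝ h).continuous.comp_aestronglyMeasurable
      ((W.aestronglyMeasurable_stepL2 hab u).mono (𝓕.mono hbt))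
  have h2 : AEStronglyMeasurable[𝓕 t] (A.indicator fun ω =>
      W.toIsometry (stepL2 a b u) ω • h) P := h1.indicator_of_le (𝓕.mono (hab.trans hbt) _ hA)
  exact h2.congr (MemLp.coeFn_toLp _).symm

/-- The integrands which vanish after `t` and have an Itô integral. -/
noncomputable def itoDomain (H : Type*) [NormedAddCommGroup H] [InnerProductSpace ℝ H] [CompleteSpace H]
    (t : Set.Icc (0 : ℝ) T) : Submodule ℝ (Lp (HilbertSchmidt U H) 2 ((timeMeasure T).prod P)) :=
  (W.itoGraph H t).map (LinearMap.fst ℝ _ _)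

/-- By the isometry, convergent integrands have Cauchy integrals. These converge by completeness,
and the limiting pair lies in the closed graph. -/
theorem isClosed_itoDomain (t : Set.Icc (0 : ℝ) T) :
    IsClosed (W.itoDomain H t : Set (Lp (HilbertSchmidt U H) 2 ((timeMeasure T).prod P))) := by
  rw [← isSeqClosed_iff_isClosed]
  intro x x₀ hx hx₀
  choose p hp hpx using hx
  have hpx' : ∀ n, (p n).1 = x n := hpx
  have hcauchy : CauchySeq fun n => (p n).2 := by
    rw [Metric.cauchySeq_iff]
    intro ε hε
    obtain ⟨N, hN⟩ := Metric.cauchySeq_iff.1 hx₀.cauchySeq ε hε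
    refine ⟨N, fun m hm n hn => ?_⟩
    have h := W.norm_itoGraph (Submodule.sub_mem _ (hp m) (hp n))
    rw [Prod.fst_sub, Prod.snd_sub, hpx', hpx'] at h
    rw [dist_eq_norm, ← h, ← dist_eq_norm]
    exact hN m hm n hn
  obtain ⟨y, hy⟩ := cauchySeq_tendsto_of_complete hcauchy
  refine ⟨(x₀, y), (W.isClosed_itoGraph t).mem_of_tendsto (f := p) (b := atTop) ?_
    (Eventually.of_forall hp), rfl⟩
  refine Tendsto.prodMk_nhds ?_ hy
  simpa only [hpx'] using hx₀

/-- For a fixed rectangle the admissible operators form a closed subspace; it contains the rank-one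
operators, whose span is dense. -/
theorem containsRectangles_itoDomain (t : Set.Icc (0 : ℝ) T) :
    ContainsRectangles 𝓕 (W.itoDomain H t) t := by
  intro a b hab hbt A hA v
  have hc : IsClosed (((W.itoDomain H t).comap (indicatorConstLpL (HilbertSchmidt U H)
      (measurableSet_Ioc_prod (b := b) hA) (measure_ne_top ((timeMeasure T).prod P) _)).toLinearMap :
      Submodule ℝ (HilbertSchmidt U H)) : Set (HilbertSchmidt U H)) :=
    (W.isClosed_itoDomain t).preimage (ContinuousLinearMap.continuous _)
  have hv : v ∈ (Submodule.span ℝ (Set.range fun p : H × U =>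
      HilbertSchmidt.rankOne p.1 p.2)).topologicalClosure := by
    rw [HilbertSchmidt.closure_span_rankOne]
    trivial
  refine Submodule.topologicalClosure_minimal _ (Submodule.span_le.2 ?_) hc hv
  rintro _ ⟨⟨h, u⟩, rfl⟩
  exact ⟨_, Submodule.le_topologicalClosure _ (Submodule.subset_span
    ⟨a, b, hab, hbt, A, hA, u, h, rfl⟩), rfl⟩

theorem coeFn_sum_rectangle (φ : ElementaryProcess 𝓕 U H) :
    ⇑(∑ k, rectangle P (b := φ.t k) (φ.measurable k) (φ.u k) (φ.h k))
      =ᵐ[(timeMeasure T).prod P] φ.eval := by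
  have h1 : ∀ᵐ x ∂((timeMeasure T).prod P), ∀ k,
      rectangle P (b := φ.t k) (φ.measurable k) (φ.u k) (φ.h k) x =
        (Set.Ioc (φ.s k) (φ.t k) ×ˢ φ.A k).indicator
          (fun _ => HilbertSchmidt.rankOne (φ.h k) (φ.u k)) x :=
    ae_all_iff.2 fun k => indicatorConstLp_coeFn
  filter_upwards [h1, Lp.coeFn_finset_sum Finset.univ fun k =>
    rectangle P (b := φ.t k) (φ.measurable k) (φ.u k) (φ.h k)] with x e1 e2
  rw [e2]
  exact Finset.sum_congr rfl fun k _ => e1 k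

theorem coeFn_sum_rectangleIntegral (φ : ElementaryProcess 𝓕 U H) :
    ⇑(∑ k, W.rectangleIntegral (φ.s k) (φ.t k) (φ.measurable k) (φ.u k) (φ.h k))
      =ᵐ[P] φ.integral W := by
  have h1 : ∀ᵐ ω ∂P, ∀ k,
      W.rectangleIntegral (φ.s k) (φ.t k) (φ.measurable k) (φ.u k) (φ.h k) ω =
        (φ.A k).indicator
          (fun ω' => W.toIsometry (stepL2 (φ.s k) (φ.t k) (φ.u k)) ω' • φ.h k) ω :=
    ae_all_iff.2 fun k => MemLp.coeFn_toLp _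
  filter_upwards [h1, Lp.coeFn_finset_sum Finset.univ fun k =>
    W.rectangleIntegral (φ.s k) (φ.t k) (φ.measurable k) (φ.u k) (φ.h k)] with x e1 e2
  rw [e2]
  exact Finset.sum_congr rfl fun k _ => e1 k

theorem smul_rectangle {a b : Set.Icc (0 : ℝ) T} {A : Set Ω} (hA : MeasurableSet[𝓕 a] A) (u : U)
    (h : H) (c : ℝ) :
    c • rectangle P (b := b) hA u h = rectangle P (b := b) hA u (c • h) := by
  rw [rectangle, rectangle, HilbertSchmidt.rankOne_smul_left]
  exact (map_smul (indicatorConstLpL (HilbertSchmidt U H) (measurableSet_Ioc_prod (b := b) hA)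
    (measure_ne_top ((timeMeasure T).prod P) _)) c _).symm

theorem smul_rectangleIntegral {a b : Set.Icc (0 : ℝ) T} {A : Set Ω} (hA : MeasurableSet[𝓕 a] A)
    (u : U) (h : H) (c : ℝ) :
    c • W.rectangleIntegral a b hA u h = W.rectangleIntegral a b hA u (c • h) := by
  rw [rectangleIntegral, rectangleIntegral, ← MemLp.toLp_const_smul]
  congr 1
  ext ω
  by_cases hω : ω ∈ A <;> simp [hω, smul_comm c]

theorem exists_elementary_ae_eq {t : Set.Icc (0 : ℝ) T}
    {p : Lp (HilbertSchmidt U H) 2 ((timeMeasure T).prod P) × Lp H 2 P}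
    (hp : p ∈ W.elementaryGraph H t) : ∃ φ : ElementaryProcess 𝓕 U H,
      p.1 =ᵐ[(timeMeasure T).prod P] φ.eval ∧ p.2 =ᵐ[P] φ.integral W := by
  obtain ⟨n, c, g, rfl⟩ := Submodule.mem_span_set'.1 hp
  choose a b hab hbt A hA u h hg using fun i => (g i).2
  -- Elementary processes carry no scalar coefficients, so these are absorbed into the vectors of
  -- `H`.
  let φ : ElementaryProcess 𝓕 U H := ⟨n, a, b, A, u, fun i => c i • h i, hab, hA⟩
  refine ⟨φ, ?_, ?_⟩
  · refine EventuallyEq.trans (EventuallyEq.of_eq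
      (congrArg (fun f : Lp (HilbertSchmidt U H) 2 ((timeMeasure T).prod P) => ⇑f) ?_))
      (coeFn_sum_rectangle (P := P) φ)
    rw [Prod.fst_sum]
    refine Finset.sum_congr rfl fun i _ => ?_
    rw [hg i, Prod.smul_fst, smul_rectangle]
  · refine EventuallyEq.trans (EventuallyEq.of_eq (congrArg (fun f : Lp H 2 P => ⇑f) ?_))
      (W.coeFn_sum_rectangleIntegral φ)
    rw [Prod.snd_sum]
    refine Finset.sum_congr rfl fun i _ => ?_
    rw [hg i, Prod.smul_snd, smul_rectangleIntegral]

theorem exists_mem_elementaryGraph (φ : ElementaryProcess 𝓕 U H) :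
    ∃ p ∈ W.elementaryGraph H ⊤,
      p.1 =ᵐ[(timeMeasure T).prod P] φ.eval ∧ p.2 =ᵐ[P] φ.integral W := by
  refine ⟨∑ k, (rectangle P (b := φ.t k) (φ.measurable k) (φ.u k) (φ.h k),
    W.rectangleIntegral (φ.s k) (φ.t k) (φ.measurable k) (φ.u k) (φ.h k)),
    Submodule.sum_mem _ fun k _ => Submodule.subset_span
      ⟨φ.s k, φ.t k, φ.le k, le_top, φ.A k, φ.measurable k, φ.u k, φ.h k, rfl⟩, ?_, ?_⟩
  · rw [Prod.fst_sum]
    exact coeFn_sum_rectangle (P := P) φ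
  · rw [Prod.snd_sum]
    exact W.coeFn_sum_rectangleIntegral φ

/-- An Itô integral is a point of the closed graph of the Itô integral. -/
theorem mem_itoGraph_of_tendsto {Φ : Lp (HilbertSchmidt U H) 2 ((timeMeasure T).prod P)}
    {Y : Lp H 2 P} {φ : ℕ → ElementaryProcess 𝓕 U H}
    (h1 : Tendsto (fun n => eLpNorm (fun x => Φ x - (φ n).eval x) 2 ((timeMeasure T).prod P)) atTop
      (𝓝 0))
    (h2 : Tendsto (fun n => eLpNorm (fun ω => Y ω - (φ n).integral W ω) 2 P) atTop (𝓝 0)) :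
    (Φ, Y) ∈ W.itoGraph H ⊤ := by
  choose p hp hp1 hp2 using fun n => W.exists_mem_elementaryGraph (φ n)
  refine mem_closure_of_tendsto (f := p) (b := atTop) ?_ (Eventually.of_forall hp)
  refine Tendsto.prodMk_nhds (mx := fun n => (p n).1) (my := fun n => (p n).2) ?_ ?_
  · rw [tendsto_iff_edist_tendsto_0]
    refine h1.congr fun n => ?_
    rw [edist_comm, Lp.edist_def]
    refine eLpNorm_congr_ae ?_
    filter_upwards [hp1 n] with x hx
    rw [Pi.sub_apply, hx]
  · rw [tendsto_iff_edist_tendsto_0]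
    refine h2.congr fun n => ?_
    rw [edist_comm, Lp.edist_def]
    refine eLpNorm_congr_ae ?_
    filter_upwards [hp2 n] with x hx
    rw [Pi.sub_apply, hx]

theorem exists_tendsto_of_mem_itoGraph {t : Set.Icc (0 : ℝ) T}
    {p : Lp (HilbertSchmidt U H) 2 ((timeMeasure T).prod P) × Lp H 2 P}
    (hp : p ∈ W.itoGraph H t) : ∃ φ : ℕ → ElementaryProcess 𝓕 U H,
      Tendsto (fun n => eLpNorm (fun x => p.1 x - (φ n).eval x) 2 ((timeMeasure T).prod P)) atTop
        (𝓝 0) ∧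
      Tendsto (fun n => eLpNorm (fun ω => p.2 ω - (φ n).integral W ω) 2 P) atTop (𝓝 0) := by
  obtain ⟨q, hq, hqp⟩ := mem_closure_iff_seq_limit.1 hp
  choose φ h1 h2 using fun n => W.exists_elementary_ae_eq (hq n)
  refine ⟨φ, ?_, ?_⟩
  · have h := tendsto_iff_edist_tendsto_0.1 ((continuous_fst.tendsto p).comp hqp)
    refine h.congr fun n => ?_
    rw [Function.comp_apply, edist_comm, Lp.edist_def]
    refine eLpNorm_congr_ae ?_
    filter_upwards [h1 n] with x hx
    rw [Pi.sub_apply, hx]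
  · have h := tendsto_iff_edist_tendsto_0.1 ((continuous_snd.tendsto p).comp hqp)
    refine h.congr fun n => ?_
    rw [Function.comp_apply, edist_comm, Lp.edist_def]
    refine eLpNorm_congr_ae ?_
    filter_upwards [h2 n] with x hx
    rw [Pi.sub_apply, hx]

end CylindricalBM

end Isometry

/-! ### Properties shared by the pathwise integral and the Itô integral -/

section IntegralRelation

variable {T : ℝ} [Fact (0 ≤ T)] {Ω : Type*} {mΩ : MeasurableSpace Ω}

/-- `R Z Y`, read as `Y = ∫_0^T Z`, is a linear relation which is bounded in `L²`, and the
integral of a continuous adapted process over `[0, t]` exists and is `𝓕 t`-measurable. -/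
structure IsIntegralRelation (𝓕 : Filtration (Set.Icc (0 : ℝ) T) mΩ) {P : Measure Ω} {V H : Type*}
    [NormedAddCommGroup V] [NormedSpace ℝ V] [NormedAddCommGroup H] [NormedSpace ℝ H]
    (R : (Set.Icc (0 : ℝ) T → Lp V 2 P) → Lp H 2 P → Prop) (C : ℝ≥0) : Prop where
  exists_integral : ∀ (z : AdaptedC 𝓕 P V) (t : Set.Icc (0 : ℝ) T),
    ∃ Y ∈ lpMeas H ℝ (𝓕 t) 2 P, R ((Set.Iic t).indicator z.1) Y
  add : ∀ {Z Z' Y Y'}, R Z Y → R Z' Y' → R (Z + Z') (Y + Y')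
  const_smul : ∀ (c : ℝ) {Z Y}, R Z Y → R (c • Z) (c • Y)
  bound : ∀ {Z Y}, R Z Y → ‖Y‖ₑ ^ 2 ≤ C * ∫⁻ s, ‖Z s‖ₑ ^ 2 ∂(timeMeasure T)

variable {𝓕 : Filtration (Set.Icc (0 : ℝ) T) mΩ} {P : Measure Ω}

theorem AdaptedC.lintegral_enorm_sq_ne_top {V : Type*} [NormedAddCommGroup V] [NormedSpace ℝ V]
    (z : AdaptedC 𝓕 P V) (t : Set.Icc (0 : ℝ) T) :
    ∫⁻ s, ‖(Set.Iic t).indicator z.1 s‖ₑ ^ 2 ∂(timeMeasure T) ≠ ∞ := by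
  have h : ∀ s, ‖(Set.Iic t).indicator z.1 s‖ₑ ^ 2 ≤ ‖z.1‖ₑ ^ 2 := fun s => by
    refine pow_le_pow_left' ((enorm_indicator_le_enorm_self _ _).trans ?_) 2
    rw [← ofReal_norm, ← ofReal_norm]
    exact ENNReal.ofReal_le_ofReal (z.1.norm_coe_le_norm s)
  refine ne_top_of_le_ne_top ?_ (lintegral_mono h)
  rw [lintegral_const]
  exact ENNReal.mul_ne_top (by simp) (measure_ne_top _ _)

variable [IsProbabilityMeasure P]

section Ito

variable {U H : Type*} [NormedAddCommGroup U] [InnerProductSpace ℝ U] [CompleteSpace U]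
  [NormedAddCommGroup H] [InnerProductSpace ℝ H] [CompleteSpace H] (W : CylindricalBM 𝓕 P U)

/-- Square integrability of `Φ` is automatic: it is at finite `L²` distance from some elementary
process. Approximation by elementary processes is then membership in the closed graph. -/
theorem isItoIntegral_iff {Z : Set.Icc (0 : ℝ) T → Lp (HilbertSchmidt U H) 2 P} {Y : Lp H 2 P} :
    IsItoIntegral W Z Y ↔ ∃ Φ : Set.Icc (0 : ℝ) T → Ω → HilbertSchmidt U H,
      IsPredictableVersion 𝓕 Φ Z ∧ ∃ hΦ : MemLp (fun x : Set.Icc (0 : ℝ) T × Ω => Φ x.1 x.2) 2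
        ((timeMeasure T).prod P), (hΦ.toLp _, Y) ∈ W.itoGraph H ⊤ := by
  constructor
  · rintro ⟨Φ, hΦ, φ, h1, h2⟩
    have hmem : MemLp (fun x : Set.Icc (0 : ℝ) T × Ω => Φ x.1 x.2) 2 ((timeMeasure T).prod P) := by
      obtain ⟨n, hn⟩ := (h1.eventually_lt_const (u := 1) one_pos).exists
      obtain ⟨p, -, hp, -⟩ := W.exists_mem_elementaryGraph (φ n)
      have h3 : MemLp (φ n).eval 2 ((timeMeasure T).prod P) := (Lp.memLp p.1).ae_eq hp
      have h4 : MemLp (fun x : Set.Icc (0 : ℝ) T × Ω => Φ x.1 x.2 - (φ n).eval x) 2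
          ((timeMeasure T).prod P) :=
        ⟨hΦ.stronglyMeasurable.aestronglyMeasurable.sub h3.1, hn.trans ENNReal.one_lt_top⟩
      refine (h4.add h3).ae_eq (Eventually.of_forall fun x => ?_)
      simp
    refine ⟨Φ, hΦ, hmem, W.mem_itoGraph_of_tendsto (φ := φ) (h1.congr fun n => ?_) h2⟩
    refine eLpNorm_congr_ae ?_
    filter_upwards [hmem.coeFn_toLp] with x hx
    rw [hx]
  · rintro ⟨Φ, hΦ, hmem, hY⟩
    obtain ⟨φ, h1, h2⟩ := W.exists_tendsto_of_mem_itoGraph hY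
    refine ⟨Φ, hΦ, φ, h1.congr fun n => ?_, h2⟩
    refine eLpNorm_congr_ae ?_
    filter_upwards [hmem.coeFn_toLp] with x hx
    rw [hx]

/-- Existence is obtained in the graph of integrands supported before `t`, not merely in the full
graph, because that also yields `𝓕 t`-measurability of the integral. -/
theorem isIntegralRelation_ito : IsIntegralRelation 𝓕 (IsItoIntegral (H := H) W) 1 where
  exists_integral z t := by
    obtain ⟨Φ, hΦ, -⟩ := z.exists_isPredictableVersion t
    have hmem := hΦ.memLp (z.lintegral_enorm_sq_ne_top t)
    obtain ⟨⟨_, Y⟩, hp, rfl⟩ := (W.containsRectangles_itoDomain t).toLp_mem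
      (W.isClosed_itoDomain t) hΦ hmem
    exact ⟨Y, W.mem_lpMeas_of_mem_itoGraph hp,
      (isItoIntegral_iff W).2 ⟨Φ, hΦ, hmem, W.itoGraph_mono le_top hp⟩⟩
  add h h' := by
    obtain ⟨Φ, hΦ, hmem, hY⟩ := (isItoIntegral_iff W).1 h
    obtain ⟨Φ', hΦ', hmem', hY'⟩ := (isItoIntegral_iff W).1 h'
    exact (isItoIntegral_iff W).2 ⟨Φ + Φ', hΦ.add hΦ', hmem.add hmem', Submodule.add_mem _ hY hY'⟩
  const_smul c _ _ h := by
    obtain ⟨Φ, hΦ, hmem, hY⟩ := (isItoIntegral_iff W).1 h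
    exact (isItoIntegral_iff W).2
      ⟨c • Φ, hΦ.const_smul c, hmem.const_smul c, Submodule.smul_mem _ c hY⟩
  bound h := by
    obtain ⟨Φ, hΦ, hmem, hY⟩ := (isItoIntegral_iff W).1 h
    have h1 := W.norm_itoGraph hY
    rw [← hΦ.eLpNorm_sq, ENNReal.coe_one, one_mul, ← Lp.enorm_toLp hmem, ← ofReal_norm,
      ← ofReal_norm, h1]

end Ito

section Pathwise

variable {H : Type*} [NormedAddCommGroup H] [InnerProductSpace ℝ H] [CompleteSpace H]

theorem lintegral_sq_le {α : Type*} {mα : MeasurableSpace α} (μ : Measure α) {f : α → H}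
    (hf : AEStronglyMeasurable f μ) :
    (∫⁻ x, ‖f x‖ₑ ∂μ) ^ 2 ≤ μ Set.univ * ∫⁻ x, ‖f x‖ₑ ^ 2 ∂μ := by
  have h := eLpNorm_le_eLpNorm_mul_rpow_measure_univ (p := 1) (q := 2) one_le_two hf
  rw [eLpNorm_one_eq_lintegral_enorm] at h
  refine (pow_le_pow_left' h 2).trans ?_
  rw [mul_pow, eLpNorm_two_sq, mul_comm, ← ENNReal.rpow_natCast, ← ENNReal.rpow_mul]
  norm_num

/-- Cauchy–Schwarz in time along each path, then Tonelli; `T` is the total mass of the time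
interval. -/
theorem IsPredictableVersion.lintegral_enorm_integral_sq_le
    {Φ : Set.Icc (0 : ℝ) T → Ω → H} {Z : Set.Icc (0 : ℝ) T → Lp H 2 P}
    (hΦ : IsPredictableVersion 𝓕 Φ Z) :
    ∫⁻ ω, ‖∫ s, Φ s ω ∂(timeMeasure T)‖ₑ ^ 2 ∂P ≤
      T.toNNReal * ∫⁻ s, ‖Z s‖ₑ ^ 2 ∂(timeMeasure T) := by
  have hm : AEMeasurable (Function.uncurry fun s ω => ‖Φ s ω‖ₑ ^ 2) ((timeMeasure T).prod P) :=
    (hΦ.stronglyMeasurable.enorm.pow_const 2).aemeasurable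
  calc ∫⁻ ω, ‖∫ s, Φ s ω ∂(timeMeasure T)‖ₑ ^ 2 ∂P
      ≤ ∫⁻ ω, timeMeasure T Set.univ * ∫⁻ s, ‖Φ s ω‖ₑ ^ 2 ∂(timeMeasure T) ∂P := by
        refine lintegral_mono fun ω => ?_
        refine (pow_le_pow_left' (enorm_integral_le_lintegral_enorm _) 2).trans
          (lintegral_sq_le _ ?_)
        exact (hΦ.stronglyMeasurable.comp_measurable measurable_prodMk_right).aestronglyMeasurable
    _ = timeMeasure T Set.univ * ∫⁻ s, ∫⁻ ω, ‖Φ s ω‖ₑ ^ 2 ∂P ∂(timeMeasure T) := by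
        rw [lintegral_const_mul' _ _ (measure_ne_top _ _), lintegral_lintegral_swap hm]
    _ = T.toNNReal * ∫⁻ s, ‖Z s‖ₑ ^ 2 ∂(timeMeasure T) := by
        rw [timeMeasure_univ]
        congr 1
        refine lintegral_congr fun s => ?_
        rw [Lp.enorm_sq_eq_lintegral]
        refine lintegral_congr_ae ?_
        filter_upwards [hΦ.2 s] with ω hω
        rw [hω]

theorem isIntegralRelation_pathwise :
    IsIntegralRelation 𝓕 (IsPathwiseIntegral (P := P) (H := H) 𝓕) T.toNNReal where
  exists_integral z t := by
    obtain ⟨Φ, hΦ, hΦt⟩ := z.exists_isPredictableVersion t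
    have hfin := z.lintegral_enorm_sq_ne_top t
    have hsm : StronglyMeasurable fun ω => ∫ s, Φ s ω ∂(timeMeasure T) :=
      StronglyMeasurable.integral_prod_left (f := Φ) hΦ.stronglyMeasurable
    have hmem : MemLp (fun ω => ∫ s, Φ s ω ∂(timeMeasure T)) 2 P := by
      refine ⟨hsm.aestronglyMeasurable, lt_top_iff_ne_top.2 fun htop => ?_⟩
      have h := hΦ.lintegral_enorm_integral_sq_le
      rw [← eLpNorm_two_sq, htop] at h
      exact (ENNReal.mul_lt_top ENNReal.coe_lt_top hfin.lt_top).not_ge (le_trans (by simp) h)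
    -- Since `Φ` vanishes after `t`, only times up to `t` are integrated. There progressive
    -- measurability, a consequence of predictability, gives joint measurability with respect to `𝓕
    -- t`.
    have hmeas : StronglyMeasurable[𝓕 t] fun ω => ∫ s, Φ s ω ∂(timeMeasure T) := by
      have h1 : (fun ω => ∫ s, Φ s ω ∂(timeMeasure T)) = fun ω =>
          ∫ s : Set.Iic t, Φ s ω ∂((timeMeasure T).comap Subtype.val) := by
        ext ω
        rw [integral_subtype_comap measurableSet_Iic (fun s => Φ s ω)]
        refine (setIntegral_eq_integral_of_forall_compl_eq_zero fun s hs => ?_).symm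
        rw [hΦt s (not_le.1 hs)]
        rfl
      rw [h1]
      have : IsFiniteMeasure ((timeMeasure T).comap (Subtype.val : Set.Iic t → _)) :=
        ⟨by
          rw [comap_subtype_coe_apply measurableSet_Iic]
          exact measure_lt_top _ _⟩
      exact @StronglyMeasurable.integral_prod_left _ _ _ _ (𝓕 t) _ _ _ _ _
        (hΦ.1.isStronglyProgressive t)
    refine ⟨hmem.toLp _, ?_, Φ, hΦ, ?_⟩
    · rw [mem_lpMeas_iff_aestronglyMeasurable]
      exact hmeas.aestronglyMeasurable.congr hmem.coeFn_toLp.symm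
    · have h1 := (hΦ.memLp hfin).integrable one_le_two
      filter_upwards [h1.prod_left_ae, hmem.coeFn_toLp] with ω h2 h3
      exact ⟨h2, h3⟩
  add {Z Z' Y Y'} h h' := by
    obtain ⟨Φ, hΦ, hY⟩ := h
    obtain ⟨Φ', hΦ', hY'⟩ := h'
    refine ⟨Φ + Φ', hΦ.add hΦ', ?_⟩
    filter_upwards [hY, hY', Lp.coeFn_add Y Y'] with ω h1 h2 h3
    refine ⟨h1.1.add h2.1, ?_⟩
    rw [h3, Pi.add_apply, h1.2, h2.2, ← integral_add h1.1 h2.1]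
    rfl
  const_smul c Z Y h := by
    obtain ⟨Φ, hΦ, hY⟩ := h
    refine ⟨c • Φ, hΦ.const_smul c, ?_⟩
    filter_upwards [hY, Lp.coeFn_smul c Y] with ω h1 h3
    refine ⟨h1.1.smul c, ?_⟩
    rw [h3, Pi.smul_apply, h1.2, ← integral_smul]
    rfl
  bound {Z Y} h := by
    obtain ⟨Φ, hΦ, hY⟩ := h
    rw [Lp.enorm_sq_eq_lintegral]
    refine le_trans (le_of_eq (lintegral_congr_ae ?_)) hΦ.lintegral_enorm_integral_sq_le
    filter_upwards [hY] with ω hω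
    rw [hω.2]

end Pathwise

end IntegralRelation

/-! ### Cylindrical convolutions -/

/-- Orbits are bounded on compact time intervals, so the uniform boundedness principle applies.
Negative `r` causes no trouble, since `toNNReal` sends it to `0`. -/
theorem C0Semigroup.exists_norm_le {E : Type*} [NormedAddCommGroup E] [NormedSpace ℝ E]
    [CompleteSpace E] (S : C0Semigroup E) (T : ℝ) :
    ∃ M : ℝ, 0 ≤ M ∧ ∀ r : ℝ, r ≤ T → ‖S.toFun r.toNNReal‖ ≤ M := by
  obtain ⟨M, hM⟩ := banach_steinhaus (g := fun r : Set.Icc (0 : ℝ≥0) T.toNNReal => S.toFun r)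
    fun e => by
      have hc : Continuous fun r : Set.Icc (0 : ℝ≥0) T.toNNReal => S.toFun r e :=
        (S.continuous_orbit e).comp continuous_subtype_val
      obtain ⟨C, hC⟩ := (isCompact_range hc).isBounded.exists_norm_le
      exact ⟨C, fun r => hC _ ⟨r, rfl⟩⟩
  exact ⟨M, (norm_nonneg _).trans (hM ⟨0, le_rfl, zero_le⟩),
    fun r hr => hM ⟨r.toNNReal, zero_le, Real.toNNReal_le_toNNReal hr⟩⟩

section Convolution

variable {T : ℝ} [Fact (0 ≤ T)] {Ω : Type*} {mΩ : MeasurableSpace Ω}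
  {𝓕 : Filtration (Set.Icc (0 : ℝ) T) mΩ} {P : Measure Ω}
  {E : Type*} [NormedAddCommGroup E] [NormedSpace ℝ E]
  {V : Type*} [NormedAddCommGroup V] [NormedSpace ℝ V]
  {H : Type*} [NormedAddCommGroup H] [NormedSpace ℝ H]

theorem lintegral_timeMeasure_pow_le (t : Set.Icc (0 : ℝ) T) {B : ℝ} (hB : 0 ≤ B) (n : ℕ)
    {g : Set.Icc (0 : ℝ) T → ℝ≥0∞} (hg : ∀ s ≤ t, g s ≤ ENNReal.ofReal (B * (s : ℝ) ^ n))
    (hg0 : ∀ s, t < s → g s = 0) :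
    ∫⁻ s, g s ∂(timeMeasure T) ≤ ENNReal.ofReal (B * ((t : ℝ) ^ (n + 1) / (n + 1))) := by
  let f : ℝ → ℝ≥0∞ := (Set.Iic (t : ℝ)).indicator fun r => ENNReal.ofReal (B * r ^ n)
  calc ∫⁻ s, g s ∂(timeMeasure T) ≤ ∫⁻ s : Set.Icc (0 : ℝ) T, f s ∂(timeMeasure T) := by
        refine lintegral_mono fun s => ?_
        rcases le_or_gt s t with h | h
        · have : f s = ENNReal.ofReal (B * (s : ℝ) ^ n) := Set.indicator_of_mem (Set.mem_Iic.2 (Subtype.coe_le_coe.2 h)) _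
          rw [this]
          exact hg s h
        · rw [hg0 s h]
          exact zero_le
    _ = ∫⁻ r in Set.Icc (0 : ℝ) T, f r := lintegral_subtype_comap measurableSet_Icc f
    _ = ∫⁻ r in Set.Ioc (0 : ℝ) t, ENNReal.ofReal (B * r ^ n) := by
        rw [lintegral_indicator measurableSet_Iic, Measure.restrict_restrict measurableSet_Iic]
        have : Set.Iic (t : ℝ) ∩ Set.Icc 0 T = Set.Icc 0 (t : ℝ) := by
          ext r
          have := t.2.2
          simp only [Set.mem_inter_iff, Set.mem_Iic, Set.mem_Icc]
          grind
        rw [this, restrict_Ioc_eq_restrict_Icc]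
    _ = ENNReal.ofReal (∫ r in Set.Ioc (0 : ℝ) t, B * r ^ n) := by
        rw [ofReal_integral_eq_lintegral_ofReal]
        · exact (by fun_prop : Continuous fun r : ℝ => B * r ^ n).integrableOn_Ioc
        · refine (ae_restrict_iff' measurableSet_Ioc).2 (Eventually.of_forall fun r hr => ?_)
          have := hr.1.le
          positivity
    _ = ENNReal.ofReal (B * ((t : ℝ) ^ (n + 1) / (n + 1))) := by
        rw [← intervalIntegral.integral_of_le t.2.1, intervalIntegral.integral_const_mul,
          integral_pow]
        simp
    _ ≤ _ := le_rfl

/-- The inclusion of `C_𝓕([0, T], L²(Ω, V))` into the space of all continuous functions. -/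
noncomputable def AdaptedC.toContinuousMapL :
    AdaptedC 𝓕 P V →L[ℝ] C(Set.Icc (0 : ℝ) T, Lp V 2 P) :=
  (adaptedSubmodule 𝓕 P V).subtypeL

theorem AdaptedC.norm_apply_le (z : AdaptedC 𝓕 P V) (s : Set.Icc (0 : ℝ) T) : ‖z.1 s‖ ≤ ‖z‖ :=
  z.1.norm_coe_le_norm s

theorem AdaptedC.norm_le_of_forall {z : AdaptedC 𝓕 P V} {c : ℝ} (hc : 0 ≤ c)
    (h : ∀ s, ‖z.1 s‖ ≤ c) : ‖z‖ ≤ c :=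
  (ContinuousMap.norm_le z.1 hc).2 h

/-- A linear, bounded and time-continuous family of adapted random variables is an element of
`L(E, C_𝓕([0, T], L²(Ω, V)))`. -/
theorem AdaptedC.exists_clm (Y : Set.Icc (0 : ℝ) T → E → Lp V 2 P)
    (hadd : ∀ t e e', Y t (e + e') = Y t e + Y t e') (hsmul : ∀ t (c : ℝ) e, Y t (c • e) = c • Y t e)
    (hmeas : ∀ t e, Y t e ∈ lpMeas V ℝ (𝓕 t) 2 P) (hcont : ∀ e, Continuous fun t => Y t e) {K : ℝ}
    (hK : 0 ≤ K) (hbound : ∀ t e, ‖Y t e‖ ≤ K * ‖e‖) :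
    ∃ X : E →L[ℝ] AdaptedC 𝓕 P V, ∀ e t, (X e).1 t = Y t e := by
  let L : E →ₗ[ℝ] AdaptedC 𝓕 P V :=
    { toFun := fun e => ⟨⟨fun t => Y t e, hcont e⟩, fun t => hmeas t e⟩
      map_add' := fun e e' => Subtype.ext (ContinuousMap.ext fun t => hadd t e e')
      map_smul' := fun c e => Subtype.ext (ContinuousMap.ext fun t => hsmul t c e) }
  exact ⟨L.mkContinuous K fun e => AdaptedC.norm_le_of_forall (by positivity)
    fun s => hbound s e, fun _ _ => rfl⟩

/-! ### Regularity of the convolution integrand -/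

section Integrand

variable (S : C0Semigroup E)

/-- Orbits are continuous and evaluation on continuous functions is jointly continuous. For second
time beyond the first, `toNNReal` freezes the semigroup at time zero, which extends the integrand
continuously across the diagonal. -/
theorem continuous_shift (e : E) (f : E →L[ℝ] AdaptedC 𝓕 P V) :
    Continuous fun p : Set.Icc (0 : ℝ) T × Set.Icc (0 : ℝ) T =>
      (f (S.toFun (Real.toNNReal ((p.1 : ℝ) - p.2)) e)).1 p.2 := by
  have h1 : Continuous fun p : Set.Icc (0 : ℝ) T × Set.Icc (0 : ℝ) T =>
      AdaptedC.toContinuousMapL (f (S.toFun (Real.toNNReal ((p.1 : ℝ) - p.2)) e)) :=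
    AdaptedC.toContinuousMapL.continuous.comp (f.continuous.comp
      ((S.continuous_orbit e).comp (continuous_real_toNNReal.comp (by fun_prop))))
  exact h1.eval continuous_snd

/-- The process `s ↦ f (S_{t - s} e)_s`. -/
noncomputable def shiftedIntegrand (f : E →L[ℝ] AdaptedC 𝓕 P V) (e : E) (t : Set.Icc (0 : ℝ) T) :
    AdaptedC 𝓕 P V :=
  ⟨⟨fun s => (f (S.toFun (Real.toNNReal ((t : ℝ) - s)) e)).1 s,
    (continuous_shift S e f).comp (continuous_const.prodMk continuous_id)⟩,
    fun s => (f (S.toFun (Real.toNNReal ((t : ℝ) - s)) e)).2 s⟩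

theorem convolutionIntegrand_eq (f : E →L[ℝ] AdaptedC 𝓕 P V) (e : E) (t : Set.Icc (0 : ℝ) T) :
    convolutionIntegrand S f e t = (Set.Iic t).indicator (shiftedIntegrand S f e t).1 := rfl

theorem convolutionIntegrand_of_le (f : E →L[ℝ] AdaptedC 𝓕 P V) (e : E)
    {s t : Set.Icc (0 : ℝ) T} (hst : s ≤ t) : convolutionIntegrand S f e t s =
      (f (S.toFun (Real.toNNReal ((t : ℝ) - s)) e)).1 s :=
  Set.indicator_of_mem (Set.mem_Iic.2 hst) _

theorem convolutionIntegrand_of_lt (f : E →L[ℝ] AdaptedC 𝓕 P V) (e : E)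
    {s t : Set.Icc (0 : ℝ) T} (hst : t < s) : convolutionIntegrand S f e t s = 0 :=
  Set.indicator_of_notMem (fun h => absurd (Set.mem_Iic.1 h) (not_le.2 hst)) _

theorem convolutionIntegrand_add (f : E →L[ℝ] AdaptedC 𝓕 P V) (e e' : E)
    (t : Set.Icc (0 : ℝ) T) : convolutionIntegrand S f (e + e') t =
      convolutionIntegrand S f e t + convolutionIntegrand S f e' t := by
  ext1 s
  rw [Pi.add_apply]
  rcases le_or_gt s t with h | h
  · simp only [convolutionIntegrand_of_le S _ _ h, map_add]
    rfl
  · simp only [convolutionIntegrand_of_lt S _ _ h, add_zero]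

theorem convolutionIntegrand_smul (f : E →L[ℝ] AdaptedC 𝓕 P V) (c : ℝ) (e : E)
    (t : Set.Icc (0 : ℝ) T) : convolutionIntegrand S f (c • e) t =
      c • convolutionIntegrand S f e t := by
  ext1 s
  rw [Pi.smul_apply]
  rcases le_or_gt s t with h | h
  · simp only [convolutionIntegrand_of_le S _ _ h, map_smul]
    rfl
  · simp only [convolutionIntegrand_of_lt S _ _ h, smul_zero]

theorem convolutionIntegrand_sub (f g : E →L[ℝ] AdaptedC 𝓕 P V) (e : E)
    (t : Set.Icc (0 : ℝ) T) : convolutionIntegrand S (f - g) e t =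
      convolutionIntegrand S f e t + (-1 : ℝ) • convolutionIntegrand S g e t := by
  ext1 s
  rw [Pi.add_apply, Pi.smul_apply, neg_one_smul, ← sub_eq_add_neg]
  rcases le_or_gt s t with h | h
  · simp only [convolutionIntegrand_of_le S _ _ h]
    rfl
  · simp only [convolutionIntegrand_of_lt S _ _ h, sub_zero]

theorem norm_convolutionIntegrand_le {M : ℝ} (hM : 0 ≤ M)
    (hS : ∀ r : ℝ, r ≤ T → ‖S.toFun r.toNNReal‖ ≤ M) (f : E →L[ℝ] AdaptedC 𝓕 P V) (e : E)
    (s t : Set.Icc (0 : ℝ) T) : ‖convolutionIntegrand S f e t s‖ ≤ ‖f‖ * (M * ‖e‖) := by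
  rcases le_or_gt s t with h | h
  · rw [convolutionIntegrand_of_le S _ _ h]
    refine (AdaptedC.norm_apply_le _ _).trans ((f.le_opNorm _).trans ?_)
    gcongr
    refine (ContinuousLinearMap.le_opNorm _ _).trans ?_
    gcongr
    exact hS _ (by have := t.2.2; have := s.2.1; linarith)
  · rw [convolutionIntegrand_of_lt S _ _ h, norm_zero]
    positivity

theorem stronglyMeasurable_convolutionIntegrand (f : E →L[ℝ] AdaptedC 𝓕 P V) (e : E)
    (t : Set.Icc (0 : ℝ) T) : StronglyMeasurable (convolutionIntegrand S f e t) :=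
  (shiftedIntegrand S f e t).1.continuous.stronglyMeasurable.indicator measurableSet_Iic

/-- Away from `s = t₀` the cut-off is locally constant in `t`; at `s = t₀` it may jump. -/
theorem tendsto_convolutionIntegrand (f : E →L[ℝ] AdaptedC 𝓕 P V) (e : E)
    {s t₀ : Set.Icc (0 : ℝ) T} (hs : s ≠ t₀) :
    Tendsto (fun t => convolutionIntegrand S f e t s) (𝓝 t₀)
      (𝓝 (convolutionIntegrand S f e t₀ s)) := by
  rcases lt_or_gt_of_ne hs with h | h
  · rw [convolutionIntegrand_of_le S _ _ h.le]
    have hc : Continuous fun t : Set.Icc (0 : ℝ) T =>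
        (f (S.toFun (Real.toNNReal ((t : ℝ) - s)) e)).1 s :=
      (continuous_shift S e f).comp (continuous_id.prodMk continuous_const)
    refine (hc.tendsto t₀).congr' ?_
    filter_upwards [lt_mem_nhds h] with t ht
    rw [convolutionIntegrand_of_le S _ _ ht.le]
  · rw [convolutionIntegrand_of_lt S _ _ h]
    refine tendsto_const_nhds.congr' ?_
    filter_upwards [gt_mem_nhds h] with t ht
    rw [convolutionIntegrand_of_lt S _ _ ht]

/-- Dominated convergence, with a constant bound from the semigroup and the single time `t₀`
discarded as a null set. -/
theorem tendsto_lintegral_convolutionIntegrand [CompleteSpace E] (f : E →L[ℝ] AdaptedC 𝓕 P V)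
    (e : E) (t₀ : Set.Icc (0 : ℝ) T) :
    Tendsto (fun t => ∫⁻ s, ‖(convolutionIntegrand S f e t +
      (-1 : ℝ) • convolutionIntegrand S f e t₀) s‖ₑ ^ 2 ∂(timeMeasure T)) (𝓝 t₀) (𝓝 0) := by
  obtain ⟨M, hM, hS⟩ := S.exists_norm_le T
  have h0 : ∫⁻ _ : Set.Icc (0 : ℝ) T, (0 : ℝ≥0∞) ∂(timeMeasure T) = 0 := lintegral_zero
  rw [← h0]
  refine tendsto_lintegral_filter_of_dominated_convergence
    (fun _ => ENNReal.ofReal ((2 * (‖f‖ * (M * ‖e‖))) ^ 2)) ?_ ?_ ?_ ?_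
  · refine Eventually.of_forall fun t => ?_
    exact ((stronglyMeasurable_convolutionIntegrand S f e t).add
      ((stronglyMeasurable_convolutionIntegrand S f e t₀).const_smul (-1 : ℝ))).enorm.pow_const 2
  · refine Eventually.of_forall fun t => Eventually.of_forall fun s => ?_
    rw [enorm_sq_le_ofReal_iff (by positivity)]
    gcongr
    rw [Pi.add_apply, Pi.smul_apply, neg_one_smul, ← sub_eq_add_neg]
    have h1 := norm_convolutionIntegrand_le S hM hS f e s t
    have h2 := norm_convolutionIntegrand_le S hM hS f e s t₀
    have h3 := norm_sub_le (convolutionIntegrand S f e t s) (convolutionIntegrand S f e t₀ s)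
    linarith
  · rw [lintegral_const]
    exact ENNReal.mul_ne_top ENNReal.ofReal_ne_top (measure_ne_top _ _)
  · have hne : ∀ᵐ s ∂(timeMeasure T), s ≠ t₀ := Measure.ae_ne _ _
    filter_upwards [hne] with s hs
    have h1 := (tendsto_convolutionIntegrand S f e hs).add_const
      ((-1 : ℝ) • convolutionIntegrand S f e t₀ s)
    rw [neg_one_smul, add_neg_cancel] at h1
    have h2 := ENNReal.Tendsto.pow (n := 2) h1.enorm
    simpa using h2

end Integrand

namespace IsIntegralRelation

variable {R : (Set.Icc (0 : ℝ) T → Lp V 2 P) → Lp H 2 P → Prop} {C : ℝ≥0}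

theorem sub (hR : IsIntegralRelation 𝓕 R C) {Z Z' : Set.Icc (0 : ℝ) T → Lp V 2 P} {Y Y' : Lp H 2 P} (h : R Z Y) (h' : R Z' Y') :
    R (Z + (-1 : ℝ) • Z') (Y - Y') := by
  have := hR.add h (hR.const_smul (-1) h')
  rwa [neg_one_smul ℝ Y', ← sub_eq_add_neg] at this

/-- The difference is an integral of the zero process, so the bound makes it vanish. -/
theorem unique (hR : IsIntegralRelation 𝓕 R C) {Z : Set.Icc (0 : ℝ) T → Lp V 2 P} {Y Y' : Lp H 2 P} (h : R Z Y) (h' : R Z Y') :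
    Y = Y' := by
  have h1 := hR.bound (hR.sub h h')
  have h2 : ∫⁻ s, ‖(Z + (-1 : ℝ) • Z) s‖ₑ ^ 2 ∂(timeMeasure T) = 0 := by
    rw [← lintegral_zero (μ := timeMeasure T)]
    refine lintegral_congr fun s => ?_
    rw [Pi.add_apply, Pi.smul_apply, neg_one_smul, add_neg_cancel]
    simp
  rw [h2, mul_zero, nonpos_iff_eq_zero] at h1
  have h3 := pow_eq_zero_iff (two_ne_zero) |>.1 h1
  rw [enorm_eq_zero] at h3
  exact sub_eq_zero.1 h3

/-- The convolution gains one power of time. -/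
theorem norm_sq_le_of_norm_sq_le (hR : IsIntegralRelation 𝓕 R C) (S : C0Semigroup E) {M : ℝ}
    (hS : ∀ r : ℝ, r ≤ T → ‖S.toFun r.toNNReal‖ ≤ M) {f : E →L[ℝ] AdaptedC 𝓕 P V} {B : ℝ}
    (hB : 0 ≤ B) {n : ℕ} (hf : ∀ e s, ‖(f e).1 s‖ ^ 2 ≤ B * (s : ℝ) ^ n * ‖e‖ ^ 2)
    {e : E} {t : Set.Icc (0 : ℝ) T} {Y : Lp H 2 P} (h : R (convolutionIntegrand S f e t) Y) :
    ‖Y‖ ^ 2 ≤ C * (B * M ^ 2 * ‖e‖ ^ 2) * ((t : ℝ) ^ (n + 1) / (n + 1)) := by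
  have ht : (0 : ℝ) ≤ t := t.2.1
  rw [← enorm_sq_le_ofReal_iff (by positivity)]
  refine (hR.bound h).trans ?_
  rw [mul_assoc, ENNReal.ofReal_mul C.coe_nonneg, ENNReal.ofReal_coe_nnreal]
  gcongr
  refine lintegral_timeMeasure_pow_le t (by positivity) n (fun s hs => ?_) fun s hs => ?_
  · have hs0 : (0 : ℝ) ≤ s := s.2.1
    rw [enorm_sq_le_ofReal_iff (by positivity), convolutionIntegrand_of_le S _ _ hs]
    refine (hf _ s).trans ?_
    have h1 : ‖S.toFun (Real.toNNReal ((t : ℝ) - s)) e‖ ≤ M * ‖e‖ := by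
      refine (ContinuousLinearMap.le_opNorm _ _).trans ?_
      gcongr
      exact hS _ (by have := t.2.2; linarith)
    calc B * (s : ℝ) ^ n * ‖S.toFun (Real.toNNReal ((t : ℝ) - s)) e‖ ^ 2
        ≤ B * (s : ℝ) ^ n * (M * ‖e‖) ^ 2 := by gcongr
      _ = B * M ^ 2 * ‖e‖ ^ 2 * (s : ℝ) ^ n := by ring
  · rw [convolutionIntegrand_of_lt S _ _ hs]
    simp

/-- The convolution of `f` with the semigroup exists as an element of
`L(E, C_𝓕([0, T], L²(Ω, H)))`. -/
theorem exists_convolution [CompleteSpace E] (hR : IsIntegralRelation 𝓕 R C)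
    (S : C0Semigroup E) (f : E →L[ℝ] AdaptedC 𝓕 P V) :
    ∃ X : E →L[ℝ] AdaptedC 𝓕 P H, ∀ e t, R (convolutionIntegrand S f e t) ((X e).1 t) := by
  obtain ⟨M, hM, hS⟩ := S.exists_norm_le T
  choose Y hYm hY using fun (t : Set.Icc (0 : ℝ) T) (e : E) =>
    hR.exists_integral (shiftedIntegrand S f e t) t
  simp only [← convolutionIntegrand_eq] at hY
  suffices h : ∃ X : E →L[ℝ] AdaptedC 𝓕 P H, ∀ e t, (X e).1 t = Y t e by
    obtain ⟨X, hX⟩ := h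
    exact ⟨X, fun e t => by rw [hX]; exact hY t e⟩
  refine AdaptedC.exists_clm (𝓕 := 𝓕) (K := √(C * (‖f‖ ^ 2 * M ^ 2) * T)) Y ?_ ?_ hYm ?_
    (Real.sqrt_nonneg _) ?_
  -- The values `Y t e` were chosen separately; uniqueness of the integral forces them to be linear
  -- in `e`.
  · intro t e e'
    refine hR.unique (hY t _) ?_
    rw [convolutionIntegrand_add]
    exact hR.add (hY t e) (hY t e')
  · intro t c e
    refine hR.unique (hY t _) ?_
    rw [convolutionIntegrand_smul]
    exact hR.const_smul c (hY t e)
  · intro e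
    refine continuous_iff_continuousAt.2 fun t₀ => ?_
    rw [ContinuousAt, tendsto_iff_edist_tendsto_0]
    have h1 : Tendsto (fun t => ‖Y t e - Y t₀ e‖ₑ ^ 2) (𝓝 t₀) (𝓝 0) := by
      have h2 := ENNReal.Tendsto.const_mul (a := (C : ℝ≥0∞))
        (tendsto_lintegral_convolutionIntegrand S f e t₀) (Or.inr ENNReal.coe_ne_top)
      rw [mul_zero] at h2
      exact tendsto_of_tendsto_of_tendsto_of_le_of_le tendsto_const_nhds h2 (fun _ => zero_le)
        fun t => hR.bound (hR.sub (hY t e) (hY t₀ e))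
    have h3 := (ENNReal.continuous_rpow_const (y := 1 / 2)).tendsto 0 |>.comp h1
    rw [ENNReal.zero_rpow_of_pos (by norm_num)] at h3
    refine h3.congr fun t => ?_
    rw [Function.comp_apply, edist_eq_enorm_sub, ← ENNReal.rpow_natCast, ← ENNReal.rpow_mul]
    norm_num
  · intro t e
    -- Boundedness of the convolution is the case `n = 0` of the time-gain estimate.
    have hf : ∀ e (s : Set.Icc (0 : ℝ) T), ‖(f e).1 s‖ ^ 2 ≤ ‖f‖ ^ 2 * (s : ℝ) ^ 0 * ‖e‖ ^ 2 :=
      fun e s => by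
        rw [pow_zero, mul_one, ← mul_pow]
        gcongr
        exact (AdaptedC.norm_apply_le _ _).trans (f.le_opNorm e)
    have h := hR.norm_sq_le_of_norm_sq_le S hS (by positivity) hf (hY t e)
    have hT : (0 : ℝ) ≤ T := Fact.out
    refine (sq_le_sq₀ (norm_nonneg _) (by positivity)).1 (h.trans ?_)
    rw [mul_pow, Real.sq_sqrt (by positivity)]
    simp only [zero_add, pow_one, Nat.cast_zero, div_one]
    calc C * (‖f‖ ^ 2 * M ^ 2 * ‖e‖ ^ 2) * (t : ℝ) ≤ C * (‖f‖ ^ 2 * M ^ 2 * ‖e‖ ^ 2) * T := by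
          gcongr
          exact t.2.2
      _ = C * (‖f‖ ^ 2 * M ^ 2) * T * ‖e‖ ^ 2 := by ring

end IsIntegralRelation

end Convolution

/-! ### Existence and uniqueness of mild solutions -/

section MildSolution

variable {T : ℝ} [Fact (0 ≤ T)] {Ω : Type*} {mΩ : MeasurableSpace Ω}
  {𝓕 : Filtration (Set.Icc (0 : ℝ) T) mΩ} {P : Measure Ω}
  {E : Type*} [NormedAddCommGroup E] [NormedSpace ℝ E]
  {V V' : Type*} [NormedAddCommGroup V] [NormedSpace ℝ V]
  [NormedAddCommGroup V'] [NormedSpace ℝ V']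

instance [CompleteSpace V] : CompleteSpace (AdaptedC 𝓕 P V) := by
  have h : IsClosed (adaptedSubmodule 𝓕 P V : Set C(Set.Icc (0 : ℝ) T, Lp V 2 P)) := by
    have : (adaptedSubmodule 𝓕 P V : Set C(Set.Icc (0 : ℝ) T, Lp V 2 P)) =
        ⋂ t, (fun X : C(Set.Icc (0 : ℝ) T, Lp V 2 P) => X t) ⁻¹'
          {f | AEStronglyMeasurable[𝓕 t] f P} := by
      ext X
      simp only [Set.mem_iInter]
      exact Iff.rfl
    rw [this]
    exact isClosed_iInter fun t =>
      (isClosed_aestronglyMeasurable (𝓕.le t)).preimage (continuous_eval_const t)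
  exact h.completeSpace_coe

/-- Stopping at a fixed time keeps the history up to `s` and makes the global norm see nothing
later. It remains adapted because `t ⊓ s ≤ t`. -/
theorem exists_stopped (X : E →L[ℝ] AdaptedC 𝓕 P V) (s : Set.Icc (0 : ℝ) T) :
    ∃ X' : E →L[ℝ] AdaptedC 𝓕 P V, ∀ e t, (X' e).1 t = (X e).1 (t ⊓ s) := by
  refine AdaptedC.exists_clm (fun t e => (X e).1 (t ⊓ s)) ?_ ?_ ?_ ?_ (norm_nonneg X) ?_
  · intro t e e'
    rw [map_add]
    rfl
  · intro t c e
    rw [map_smul]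
    rfl
  · intro t e
    have h := (X e).2 (t ⊓ s)
    rw [mem_lpMeas_iff_aestronglyMeasurable] at h ⊢
    exact h.mono (𝓕.mono inf_le_left)
  · intro e
    exact (X e).1.continuous.comp (continuous_id.inf continuous_const)
  · intro t e
    exact (AdaptedC.norm_apply_le _ _).trans (X.le_opNorm e)

theorem norm_sq_sub_le_of_norm_sq_sub_le {X Y : E →L[ℝ] AdaptedC 𝓕 P V} {c : ℝ}
    (hc : 0 ≤ c) (h : ∀ e t, ‖((X - Y) e).1 t‖ ^ 2 ≤ c * ‖e‖ ^ 2) : ‖X - Y‖ ^ 2 ≤ c := by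
  have h1 : ‖X - Y‖ ≤ √c := by
    refine ContinuousLinearMap.opNorm_le_bound _ (Real.sqrt_nonneg _) fun e => ?_
    refine AdaptedC.norm_le_of_forall (by positivity) fun t => ?_
    refine (sq_le_sq₀ (norm_nonneg _) (by positivity)).1 ?_
    rw [mul_pow, Real.sq_sqrt hc]
    exact h e t
  calc ‖X - Y‖ ^ 2 ≤ √c ^ 2 := by gcongr
    _ = c := Real.sq_sqrt hc

/-- A Lipschitz non-anticipating coefficient is Lipschitz for the seminorms of the histories. -/
theorem IsNonanticipating.norm_sq_le
    {F : (E →L[ℝ] AdaptedC 𝓕 P V) → (E →L[ℝ] AdaptedC 𝓕 P V')} (hF : IsNonanticipating F)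
    {K : ℝ≥0} (hK : LipschitzWith K F) {X Y : E →L[ℝ] AdaptedC 𝓕 P V} {B : ℝ} (hB : 0 ≤ B) {n : ℕ}
    (h : ∀ e t, ‖((X - Y) e).1 t‖ ^ 2 ≤ B * (t : ℝ) ^ n * ‖e‖ ^ 2) (e : E)
    (s : Set.Icc (0 : ℝ) T) :
    ‖((F X - F Y) e).1 s‖ ^ 2 ≤ K ^ 2 * B * (s : ℝ) ^ n * ‖e‖ ^ 2 := by
  have hs0 : (0 : ℝ) ≤ s := s.2.1
  obtain ⟨X', hX'⟩ := exists_stopped X s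
  obtain ⟨Y', hY'⟩ := exists_stopped Y s
  have hXX' : ∀ e, (F X e).1 s = (F X' e).1 s :=
    hF X X' s fun r hr e => by rw [hX', inf_eq_left.2 hr]
  have hYY' : ∀ e, (F Y e).1 s = (F Y' e).1 s :=
    hF Y Y' s fun r hr e => by rw [hY', inf_eq_left.2 hr]
  have h1 : ‖X' - Y'‖ ^ 2 ≤ B * (s : ℝ) ^ n := by
    refine norm_sq_sub_le_of_norm_sq_sub_le (by positivity) fun e t => ?_
    have h2 : ((X' - Y') e).1 t = ((X - Y) e).1 (t ⊓ s) := by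
      change (X' e).1 t - (Y' e).1 t = (X e).1 (t ⊓ s) - (Y e).1 (t ⊓ s)
      rw [hX', hY']
    have h3 : (0 : ℝ) ≤ (t ⊓ s : Set.Icc (0 : ℝ) T) := (t ⊓ s).2.1
    have h4 : ((t ⊓ s : Set.Icc (0 : ℝ) T) : ℝ) ≤ s := Subtype.coe_le_coe.2 inf_le_right
    rw [h2]
    refine (h e _).trans ?_
    gcongr
  have h5 : ((F X - F Y) e).1 s = ((F X' - F Y') e).1 s := by
    change (F X e).1 s - (F Y e).1 s = (F X' e).1 s - (F Y' e).1 s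
    rw [hXX', hYY']
  have h6 : ‖((F X - F Y) e).1 s‖ ≤ K * ‖X' - Y'‖ * ‖e‖ := by
    rw [h5]
    refine (AdaptedC.norm_apply_le _ _).trans ((ContinuousLinearMap.le_opNorm _ _).trans ?_)
    gcongr
    exact hK.norm_sub_le X' Y'
  calc ‖((F X - F Y) e).1 s‖ ^ 2 ≤ (K * ‖X' - Y'‖ * ‖e‖) ^ 2 := by gcongr
    _ = K ^ 2 * ‖X' - Y'‖ ^ 2 * ‖e‖ ^ 2 := by ring
    _ ≤ K ^ 2 * (B * (s : ℝ) ^ n) * ‖e‖ ^ 2 := by gcongr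
    _ = K ^ 2 * B * (s : ℝ) ^ n * ‖e‖ ^ 2 := by ring

theorem exists_semigroup_initial [CompleteSpace E] (S : C0Semigroup E)
    (X₀ : E →L[ℝ] lpMeas V ℝ (𝓕 ⊥) 2 P) :
    ∃ X : E →L[ℝ] AdaptedC 𝓕 P V,
      ∀ e t, (X e).1 t = (X₀ (S.toFun (Real.toNNReal (t : ℝ)) e)).1 := by
  obtain ⟨M, hM, hS⟩ := S.exists_norm_le T
  refine AdaptedC.exists_clm (K := ‖X₀‖ * M)
    (fun t e => (X₀ (S.toFun (Real.toNNReal (t : ℝ)) e)).1) ?_ ?_ ?_ ?_ (by positivity) ?_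
  · intro t e e'
    rw [map_add, map_add]
    rfl
  · intro t c e
    rw [map_smul, map_smul]
    rfl
  · intro t e
    have h := (X₀ (S.toFun (Real.toNNReal (t : ℝ)) e)).2
    rw [mem_lpMeas_iff_aestronglyMeasurable] at h ⊢
    exact h.mono (𝓕.mono bot_le)
  · intro e
    exact continuous_subtype_val.comp (X₀.continuous.comp ((S.continuous_orbit e).comp
      (continuous_real_toNNReal.comp continuous_subtype_val)))
  · intro t e
    refine (X₀.le_opNorm _).trans ?_
    rw [mul_assoc]
    gcongr
    refine (ContinuousLinearMap.le_opNorm _ _).trans ?_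
    gcongr
    exact hS _ t.2.2

/-- A map which gains one power of time has a unique fixed point. -/
theorem existsUnique_fixedPoint_of_gain [CompleteSpace V]
    {Ψ : (E →L[ℝ] AdaptedC 𝓕 P V) → (E →L[ℝ] AdaptedC 𝓕 P V)} {L : ℝ} (hL : 0 ≤ L)
    (h : ∀ (X Y : E →L[ℝ] AdaptedC 𝓕 P V) (B : ℝ) (n : ℕ), 0 ≤ B →
      (∀ e t, ‖((X - Y) e).1 t‖ ^ 2 ≤ B * (t : ℝ) ^ n * ‖e‖ ^ 2) →
      ∀ e t, ‖((Ψ X - Ψ Y) e).1 t‖ ^ 2 ≤ L * B / (n + 1) * (t : ℝ) ^ (n + 1) * ‖e‖ ^ 2) :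
    ∃! X, Ψ X = X := by
  have hT : (0 : ℝ) ≤ T := Fact.out
  have key : ∀ (X Y : E →L[ℝ] AdaptedC 𝓕 P V) (n : ℕ) (e : E) (t : Set.Icc (0 : ℝ) T),
      ‖((Ψ^[n] X - Ψ^[n] Y) e).1 t‖ ^ 2 ≤
        ‖X - Y‖ ^ 2 * (L ^ n / n.factorial) * (t : ℝ) ^ n * ‖e‖ ^ 2 := by
    intro X Y n
    induction n with
    | zero =>
      intro e t
      simp only [Function.iterate_zero, id, pow_zero, Nat.factorial_zero, Nat.cast_one, div_one,
        mul_one]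
      rw [← mul_pow]
      gcongr
      exact (AdaptedC.norm_apply_le _ _).trans (ContinuousLinearMap.le_opNorm _ _)
    | succ n ih =>
      intro e t
      rw [Function.iterate_succ_apply', Function.iterate_succ_apply']
      refine (h _ _ _ n (by positivity) ih e t).trans (le_of_eq ?_)
      rw [Nat.factorial_succ]
      push_cast
      field_simp
      ring
  -- The estimates are for squared norms, so `1 / 4` yields the contraction constant `1 / 2`.
  obtain ⟨n, hn⟩ := ((FloorSemiring.tendsto_pow_div_factorial_atTop (L * T)).eventually_le_const
    (by norm_num : (0 : ℝ) < 1 / 4)).exists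
  have hcontr : ContractingWith (1 / 2) Ψ^[n] := by
    refine ⟨by norm_num, LipschitzWith.of_dist_le_mul fun X Y => ?_⟩
    rw [dist_eq_norm, dist_eq_norm]
    refine (sq_le_sq₀ (norm_nonneg _) (by positivity)).1 ?_
    have h1 : ‖Ψ^[n] X - Ψ^[n] Y‖ ^ 2 ≤ ‖X - Y‖ ^ 2 * (L ^ n / n.factorial) * T ^ n := by
      refine norm_sq_sub_le_of_norm_sq_sub_le (by positivity) fun e t => ?_
      refine (key X Y n e t).trans ?_
      have := t.2.1
      gcongr
      exact t.2.2
    calc ‖Ψ^[n] X - Ψ^[n] Y‖ ^ 2 ≤ ‖X - Y‖ ^ 2 * ((L * T) ^ n / n.factorial) :=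
          h1.trans (le_of_eq (by rw [mul_pow]; ring))
      _ ≤ ‖X - Y‖ ^ 2 * (1 / 4) := by gcongr
      _ = (((1 / 2 : ℝ≥0) : ℝ) * ‖X - Y‖) ^ 2 := by push_cast; ring
  -- The fixed point of the iterate is unique and `Ψ` commutes with the iterate, so it is fixed by
  -- `Ψ`; conversely a fixed point of `Ψ` is one of the iterate.
  refine ⟨_, hcontr.isFixedPt_fixedPoint_iterate, fun X hX => ?_⟩
  exact hcontr.fixedPoint_unique (Function.IsFixedPt.iterate hX n)

end MildSolution

theorem mainTheorem2
    {T : ℝ} [Fact (0 ≤ T)]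
    {Ω : Type*} {mΩ : MeasurableSpace Ω} (P : Measure Ω) [IsProbabilityMeasure P]
    (𝓕 : Filtration (Set.Icc (0 : ℝ) T) mΩ) (h𝓕 : UsualConditions 𝓕 P)
    {U : Type*} [NormedAddCommGroup U] [InnerProductSpace ℝ U] [CompleteSpace U]
    [TopologicalSpace.SeparableSpace U]
    {H : Type*} [NormedAddCommGroup H] [InnerProductSpace ℝ H] [CompleteSpace H]
    [TopologicalSpace.SeparableSpace H]
    (W : CylindricalBM 𝓕 P U)
    {E : Type*} [NormedAddCommGroup E] [NormedSpace ℝ E] [CompleteSpace E]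
    (S : C0Semigroup E)
    (X₀ : E →L[ℝ] lpMeas H ℝ (𝓕 ⊥) 2 P)
    (F : (E →L[ℝ] AdaptedC 𝓕 P H) → (E →L[ℝ] AdaptedC 𝓕 P H))
    (G : (E →L[ℝ] AdaptedC 𝓕 P H) → (E →L[ℝ] AdaptedC 𝓕 P (HilbertSchmidt U H)))
    (hF : ∃ K : ℝ≥0, LipschitzWith K F) (hG : ∃ K : ℝ≥0, LipschitzWith K G)
    (hF' : IsNonanticipating F) (hG' : IsNonanticipating G) :
    ∃! X : E →L[ℝ] AdaptedC 𝓕 P H, IsMildSolution W S X₀ F G X := by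
  obtain ⟨K, hK⟩ := hF
  obtain ⟨K', hK'⟩ := hG
  obtain ⟨M, hM, hS⟩ := S.exists_norm_le T
  have hI := isIntegralRelation_pathwise (𝓕 := 𝓕) (P := P) (H := H)
  have hJ := isIntegralRelation_ito (H := H) W
  obtain ⟨A, hA⟩ := exists_semigroup_initial (𝓕 := 𝓕) S X₀
  choose I hIs using fun f : E →L[ℝ] AdaptedC 𝓕 P H => hI.exists_convolution S f
  choose J hJs using fun f : E →L[ℝ] AdaptedC 𝓕 P (HilbertSchmidt U H) => hJ.exists_convolution S f
  -- Uniqueness of integrals identifies any witnesses in the mild equation with the chosen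
  -- convolutions, so it becomes a fixed point equation.
  have hsol : ∀ X, IsMildSolution W S X₀ F G X ↔ A + I (F X) + J (G X) = X := by
    intro X
    have hval : ∀ e t, ((A + I (F X) + J (G X)) e).1 t =
        (X₀ (S.toFun (Real.toNNReal (t : ℝ)) e)).1 + (I (F X) e).1 t + (J (G X) e).1 t :=
      fun e t => by
        rw [← hA]
        rfl
    constructor
    · intro hX
      ext1 e
      refine Subtype.ext (ContinuousMap.ext fun t => ?_)
      obtain ⟨I', J', hI', hJ', hX'⟩ := hX t e
      rw [hval, hX', hI.unique hI' (hIs (F X) e t), hJ.unique hJ' (hJs (G X) e t)]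
    · intro hX t e
      refine ⟨_, _, hIs (F X) e t, hJs (G X) e t, ?_⟩
      rw [← hval, hX]
  simp only [hsol]
  -- In `L`, the factor `2` comes from `(a + b) ^ 2 ≤ 2 (a ^ 2 + b ^ 2)`, `T` from the pathwise
  -- bound, the coefficient `1` of `K' ^ 2` from the Itô isometry, and `M ^ 2` from the semigroup.
  refine existsUnique_fixedPoint_of_gain
    (L := 2 * (T.toNNReal * K ^ 2 + K' ^ 2) * M ^ 2) (by positivity) fun X Y B n hB h e t => ?_
  have ht0 : (0 : ℝ) ≤ t := t.2.1
  have h1 := hI.norm_sq_le_of_norm_sq_le S hS (f := F X - F Y) (by positivity)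
    (fun e s => hF'.norm_sq_le hK hB h e s) (e := e) (t := t)
    (Y := (I (F X) e).1 t - (I (F Y) e).1 t)
    (by rw [convolutionIntegrand_sub]; exact hI.sub (hIs _ e t) (hIs _ e t))
  have h2 := hJ.norm_sq_le_of_norm_sq_le S hS (f := G X - G Y) (by positivity)
    (fun e s => hG'.norm_sq_le hK' hB h e s) (e := e) (t := t)
    (Y := (J (G X) e).1 t - (J (G Y) e).1 t)
    (by rw [convolutionIntegrand_sub]; exact hJ.sub (hJs _ e t) (hJs _ e t))
  have h3 : (((A + I (F X) + J (G X)) - (A + I (F Y) + J (G Y))) e).1 t =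
      ((I (F X) e).1 t - (I (F Y) e).1 t) + ((J (G X) e).1 t - (J (G Y) e).1 t) := by
    change ((A e).1 t + (I (F X) e).1 t + (J (G X) e).1 t) -
      ((A e).1 t + (I (F Y) e).1 t + (J (G Y) e).1 t) = _
    abel
  rw [h3]
  have h4 := norm_add_le ((I (F X) e).1 t - (I (F Y) e).1 t) ((J (G X) e).1 t - (J (G Y) e).1 t)
  set a := ‖(I (F X) e).1 t - (I (F Y) e).1 t‖
  set b := ‖(J (G X) e).1 t - (J (G Y) e).1 t‖
  calc ‖((I (F X) e).1 t - (I (F Y) e).1 t) + ((J (G X) e).1 t - (J (G Y) e).1 t)‖ ^ 2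
      ≤ (a + b) ^ 2 := by gcongr
    _ ≤ 2 * (a ^ 2 + b ^ 2) := add_sq_le
    _ ≤ 2 * (T.toNNReal * (K ^ 2 * B * M ^ 2 * ‖e‖ ^ 2) * ((t : ℝ) ^ (n + 1) / (n + 1)) +
          (1 : ℝ≥0) * (K' ^ 2 * B * M ^ 2 * ‖e‖ ^ 2) * ((t : ℝ) ^ (n + 1) / (n + 1))) := by
        gcongr
    _ = _ := by
        push_cast
        ring
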